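/- Let $A\in\mathbb{C}^{m\times n}$ be a nonzero matrix of rank $k$ with spectral norm $\|A\|$, Frobenius norm $\|A\|_F$, minimum nonzero singular value $\sigma_{\min}(A)$ and condition number $\kappa=\|A\|/\sigma_{\min}(A)$, and let $A^{-1}$ denote its Moore–Penrose pseudo-inverse. Let $b\in\mathbb{C}^m$. For a nonzero vector $v$ let $\mathcal{D}_v$ be the distribution on indices with $\mathcal{D}_v(j)=|v(j)|^2/\|v\|^2$. Suppose that $A$ and $b$ are accessible only through the following queries: sample a row index $i$ of $A$ with probability $\|A(i,\cdot)\|^2/\|A\|_F^2$; for a given row $i$, sample a column index from $\mathcal{D}_{A(i,\cdot)}$; sample an index from $\mathcal{D}_b$; read an entry $A(i,j)$ or $b(i)$; read a norm $\|A(i,\cdot)\|$, $\|A\|_F$ or $\|b\|$. There exists a randomized algorithm (a single program for a random access machine with exact complex arithmetic, in which every elementary operation and every query takes one unit of time) which, given $m$, $n$, an index $i\in\{1,\dots,n\}$, $k$, $\kappa$, a precision $\epsilon>0$ and a failure probability $\delta\in(0,1)$, together with the above access to $A$ and $b$, always halts and outputs with probability at least $1-\delta$ a complex number $z$ with $|z-(A^{-1}b)(i)|\le\epsilon$.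 The number of queries and the running time are both at most $$\mathrm{poly}\left(k,\kappa,\|A\|_F,\tfrac{1}{\|A\|},\|b\|,\tfrac{1}{\epsilon}\right)\cdot\mathrm{polylog}(m,n)\cdot\left(1+\log\tfrac{1}{\delta}\right),$$ that is, at most $C\,(1+k+\kappa+\|A\|_F+\tfrac{1}{\|A\|}+\|b\|+\tfrac1\epsilon)^d\,(1+\log m+\log n)^d\,(1+\log\tfrac1\delta)$, where $C$ and $d$ are absolute constants, independent of $m,n,A,b,i,\epsilon,\delta$. -/

import Mathlib

/-! ## Linear algebra -/

/-- The `ℓ²` (Euclidean) norm of a complex vector. -/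
noncomputable def l2norm {n : ℕ} (v : Fin n → ℂ) : ℝ :=
  Real.sqrt (∑ j, ‖v j‖ ^ 2)

/-- The Frobenius norm of a complex matrix. -/
noncomputable def frobNorm {m n : ℕ} (A : Matrix (Fin m) (Fin n) ℂ) : ℝ :=
  Real.sqrt (∑ i, ∑ j, ‖A i j‖ ^ 2)

open scoped Matrix.Norms.L2Operator in
/-- The spectral norm (`ℓ² → ℓ²` operator norm) of a complex matrix. -/
noncomputable def specNorm {m n : ℕ} (A : Matrix (Fin m) (Fin n) ℂ) : ℝ := ‖A‖

/-- The minimum nonzero singular value of a (nonzero) matrix. -/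
noncomputable def sigmaMin {m n : ℕ} (A : Matrix (Fin m) (Fin n) ℂ) : ℝ :=
  sInf {s : ℝ | s ≠ 0 ∧ ∃ l : ℕ, s = (Matrix.toEuclideanLin A).singularValues l}

/-- The condition number of a (nonzero, possibly singular) matrix: the spectral norm divided by
the minimum nonzero singular value. -/
noncomputable def condNumber {m n : ℕ} (A : Matrix (Fin m) (Fin n) ℂ) : ℝ :=
  specNorm A / sigmaMin A

/-- The infimum in `sigmaMin` is an attained minimum. -/
theorem isLeast_sigmaMin {m n : ℕ} (A : Matrix (Fin m) (Fin n) ℂ) (hA : A ≠ 0) :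
    IsLeast {s : ℝ | s ≠ 0 ∧ ∃ l : ℕ, s = (Matrix.toEuclideanLin A).singularValues l}
      (sigmaMin A) := by
  have hne : {s : ℝ | s ≠ 0 ∧ ∃ l : ℕ,
      s = (Matrix.toEuclideanLin A).singularValues l}.Nonempty := by
    by_contra h
    have h0 : (Matrix.toEuclideanLin A).singularValues = 0 := by
      ext l
      by_contra hl
      exact h ⟨_, hl, l, rfl⟩
    rw [LinearMap.singularValues_eq_zero_iff] at h0
    exact hA ((LinearEquiv.map_eq_zero_iff _).1 h0)
  have hfin : {s : ℝ | s ≠ 0 ∧ ∃ l : ℕ,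
      s = (Matrix.toEuclideanLin A).singularValues l}.Finite := by
    refine ((Matrix.toEuclideanLin A).singularValues.support.finite_toSet.image
      (fun l => (Matrix.toEuclideanLin A).singularValues l)).subset ?_
    rintro s ⟨hs, l, rfl⟩
    exact ⟨l, Finsupp.mem_support_iff.2 hs, rfl⟩
  exact ⟨hne.csInf_mem hfin, fun s hs => csInf_le hfin.bddBelow hs⟩

/-- The Moore-Penrose pseudo-inverse. If `v_j` is an orthonormal eigenbasis of `Aᴴ A` with
eigenvalues `σ_j ^ 2`, and `u_j = A v_j / σ_j` for `σ_j ≠ 0` are the corresponding left singular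
vectors, this is `∑ σ_j⁻¹ v_j u_jᴴ = (∑ (σ_j ^ 2)⁻¹ v_j v_jᴴ) Aᴴ`, the sums over `σ_j ≠ 0`
(in Lean, `0⁻¹ = 0`). -/
noncomputable def pinv {m n : ℕ} (A : Matrix (Fin m) (Fin n) ℂ) : Matrix (Fin n) (Fin m) ℂ :=
  let h := Matrix.isHermitian_conjTranspose_mul_self A
  h.eigenvectorUnitary.1 *
    Matrix.diagonal (fun j => ((h.eigenvalues j)⁻¹ : ℂ)) *
    star h.eigenvectorUnitary.1 * A.conjTranspose

open scoped ComplexOrder in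
/-- `pinv A` satisfies the four Penrose equations, which characterize the pseudo-inverse. -/
theorem pinv_penrose {m n : ℕ} (A : Matrix (Fin m) (Fin n) ℂ) :
    A * pinv A * A = A ∧ pinv A * A * pinv A = pinv A ∧
      (A * pinv A).IsHermitian ∧ (pinv A * A).IsHermitian := by
  set h := Matrix.isHermitian_conjTranspose_mul_self A with hh
  set U : Matrix (Fin n) (Fin n) ℂ := h.eigenvectorUnitary.1 with hU
  set D : Matrix (Fin n) (Fin n) ℂ := Matrix.diagonal (fun j => (h.eigenvalues j : ℂ)) with hD
  set E : Matrix (Fin n) (Fin n) ℂ := Matrix.diagonal (fun j => ((h.eigenvalues j)⁻¹ : ℂ)) with hE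
  have hUU : star U * U = 1 := Unitary.coe_star_mul_self h.eigenvectorUnitary
  have hG : A.conjTranspose * A = U * D * star U := by
    have := h.spectral_theorem
    rw [Unitary.conjStarAlgAut_apply] at this
    exact this
  have hP : pinv A = U * E * star U * A.conjTranspose := rfl
  have hmul : ∀ X Y : Matrix (Fin n) (Fin n) ℂ,
      (U * X * star U) * (U * Y * star U) = U * (X * Y) * star U := by
    intro X Y
    calc (U * X * star U) * (U * Y * star U) = U * X * (star U * U) * Y * star U := by
          simp only [mul_assoc]
      _ = _ := by rw [hUU]; simp only [mul_assoc, one_mul]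
  have hEs : star E = E := by
    rw [hE, Matrix.star_eq_conjTranspose, Matrix.diagonal_conjTranspose]
    congr 1
    funext j
    simp
  have hDs : star D = D := by
    rw [hD, Matrix.star_eq_conjTranspose, Matrix.diagonal_conjTranspose]
    congr 1
    funext j
    simp
  have hED : E * D = D * E := by
    simp only [hE, hD, Matrix.diagonal_mul_diagonal, mul_comm]
  have hDED : D * (E * D) = D := by
    simp only [hE, hD, Matrix.diagonal_mul_diagonal]
    congr 1
    funext j
    by_cases hj : (h.eigenvalues j : ℂ) = 0
    · simp [hj]
    · field_simp
  have hEDE : E * D * E = E := by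
    simp only [hE, hD, Matrix.diagonal_mul_diagonal]
    congr 1
    funext j
    by_cases hj : (h.eigenvalues j : ℂ) = 0
    · simp [hj]
    · field_simp
  have hPA : pinv A * A = U * (E * D) * star U := by
    rw [hP, Matrix.mul_assoc, hG, hmul]
  have hPAs : (pinv A * A).IsHermitian := by
    rw [hPA, Matrix.IsHermitian, ← Matrix.star_eq_conjTranspose]
    simp only [star_mul, star_star, hDs, hEs, ← hED, mul_assoc]
  refine ⟨?_, ?_, ?_, hPAs⟩
  · have hz : A.conjTranspose * (A * (pinv A * A) - A) = 0 := by
      rw [Matrix.mul_sub, ← Matrix.mul_assoc, hPA, hG, hmul, hDED, sub_self]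
    have hz2 : (A * (pinv A * A) - A).conjTranspose * (A * (pinv A * A) - A) = 0 := by
      have : A * (pinv A * A) - A = A * (pinv A * A - 1) := by rw [Matrix.mul_sub, Matrix.mul_one]
      conv_lhs => lhs; rw [this]
      rw [Matrix.conjTranspose_mul, Matrix.mul_assoc, hz, Matrix.mul_zero]
    rw [Matrix.conjTranspose_mul_self_eq_zero] at hz2
    rw [Matrix.mul_assoc]
    exact sub_eq_zero.1 hz2
  · rw [hPA, hP, ← Matrix.mul_assoc, hmul, hEDE]
  · have hS : (U * E * star U).conjTranspose = U * E * star U := by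
      rw [← Matrix.star_eq_conjTranspose]
      simp only [star_mul, star_star, hEs, mul_assoc]
    rw [hP, Matrix.IsHermitian, Matrix.conjTranspose_mul, Matrix.conjTranspose_mul, hS,
      Matrix.conjTranspose_conjTranspose, Matrix.mul_assoc A]

/-! ## Sampling and query access -/

/-- The distribution `D_v` on indices: `j` is drawn with probability `|v j|² / ‖v‖²`.
For `v = 0`, where `D_v` is undefined, the value is the constant `0`. -/
noncomputable def l2Sample {n : ℕ} (v : Fin n → ℂ) : PMF ℕ :=
  open Classical in
  if h : v = 0 then PMF.pure 0
  else (PMF.ofFintype (fun j => ENNReal.ofReal (‖v j‖ ^ 2 / l2norm v ^ 2)) (by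
    have hpos : 0 < ∑ j, ‖v j‖ ^ 2 := by
      obtain ⟨j, hj⟩ := Function.ne_iff.1 h
      exact Finset.sum_pos' (fun _ _ => by positivity)
        ⟨j, Finset.mem_univ _, by have : v j ≠ 0 := hj; positivity⟩
    rw [← ENNReal.ofReal_sum_of_nonneg (fun _ _ => by positivity), ← Finset.sum_div, l2norm,
      Real.sq_sqrt hpos.le, div_self hpos.ne', ENNReal.ofReal_one])).map Fin.val

/-- Entry `j` of a vector (indices are numbered from `0`; entries out of range are `0`). -/
noncomputable def entryAt {n : ℕ} (v : Fin n → ℂ) (j : ℕ) : ℂ :=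
  if h : j < n then v ⟨j, h⟩ else 0

/-- Row `i` of a matrix (the zero row if `i` is out of range). -/
noncomputable def rowAt {m n : ℕ} (A : Matrix (Fin m) (Fin n) ℂ) (i : ℕ) : Fin n → ℂ :=
  if h : i < m then A ⟨i, h⟩ else 0

/-! ## The machine model

A randomized random access machine over the complex numbers with exact arithmetic (a real RAM).
It has an array of index cells holding natural numbers, an array of value cells holding complex
numbers, indirect addressing, and oracle instructions for the access to `A` and `b`. -/

/-- The memory: index cells and value cells. -/
structure Mem where
  idx : ℕ → ℕ
  val : ℕ → ℂ

/-- Write an index cell. -/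
def Mem.setIdx (s : Mem) (x v : ℕ) : Mem := { s with idx := Function.update s.idx x v }

/-- Write a value cell. -/
noncomputable def Mem.setVal (s : Mem) (x : ℕ) (v : ℂ) : Mem :=
  { s with val := Function.update s.val x v }

/-- The elementary instructions. The arguments `x y z` are addresses of cells, fixed in the
program text; the first one is the destination. -/
inductive Instr
  /-- `idx[x] := c` -/
  | idxConst (x c : ℕ)
  /-- `idx[x] := idx[y] + idx[z]` -/
  | idxAdd (x y z : ℕ)
  /-- `idx[x] := idx[y] - idx[z]` (truncated at zero) -/
  | idxSub (x y z : ℕ)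
  /-- `idx[x] := idx[idx[y]]` -/
  | idxLoad (x y : ℕ)
  /-- `idx[idx[x]] := idx[y]` -/
  | idxStore (x y : ℕ)
  /-- `val[x] := p + q i`, a Gaussian rational constant -/
  | valConst (x : ℕ) (p q : ℚ)
  /-- `val[x] := val[y] + val[z]` -/
  | valAdd (x y z : ℕ)
  /-- `val[x] := val[y] - val[z]` -/
  | valSub (x y z : ℕ)
  /-- `val[x] := val[y] * val[z]` -/
  | valMul (x y z : ℕ)
  /-- `val[x] := val[y] / val[z]` -/
  | valDiv (x y z : ℕ)
  /-- `val[x] :=` the complex conjugate of `val[y]` -/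
  | valConj (x y : ℕ)
  /-- `val[x] := val[idx[y]]` -/
  | valLoad (x y : ℕ)
  /-- `val[idx[x]] := val[y]` -/
  | valStore (x y : ℕ)
  /-- `idx[x] :=` a uniformly random element of `{0, …, idx[y] - 1}` (`0` if `idx[y] = 0`) -/
  | uniform (x y : ℕ)
  /-- query: `idx[x] :=` a random row index of `A`, `i` having probability `‖A(i,·)‖² / ‖A‖_F²` -/
  | sampleRow (x : ℕ)
  /-- query: `idx[x] :=` a sample from `D_{A(i,·)}`, where `i = idx[y]` -/
  | sampleCol (x y : ℕ)
  /-- query: `idx[x] :=` a sample from `D_b` -/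
  | sampleVec (x : ℕ)
  /-- query: `val[x] := A(idx[y], idx[z])` -/
  | entry (x y z : ℕ)
  /-- query: `val[x] := ‖A(idx[y],·)‖` -/
  | rowNorm (x y : ℕ)
  /-- query: `val[x] := ‖A‖_F` -/
  | matNorm (x : ℕ)
  /-- query: `val[x] := b(idx[y])` -/
  | vecEntry (x y : ℕ)
  /-- query: `val[x] := ‖b‖` -/
  | vecNorm (x : ℕ)

/-- The number of queries (`0` or `1`) made by an instruction. -/
def Instr.queries : Instr → ℕ
  | .sampleRow _ | .sampleCol _ _ | .sampleVec _ | .entry _ _ _ | .rowNorm _ _ | .matNorm _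
  | .vecEntry _ _ | .vecNorm _ => 1
  | _ => 0

/-- The (random) effect of an instruction on the memory, for the input `A`, `b`. -/
noncomputable def Instr.exec {m n : ℕ} (A : Matrix (Fin m) (Fin n) ℂ) (b : Fin m → ℂ) :
    Instr → Mem → PMF Mem
  | .idxConst x c, s => PMF.pure (s.setIdx x c)
  | .idxAdd x y z, s => PMF.pure (s.setIdx x (s.idx y + s.idx z))
  | .idxSub x y z, s => PMF.pure (s.setIdx x (s.idx y - s.idx z))
  | .idxLoad x y, s => PMF.pure (s.setIdx x (s.idx (s.idx y)))
  | .idxStore x y, s => PMF.pure (s.setIdx (s.idx x) (s.idx y))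
  | .valConst x p q, s => PMF.pure (s.setVal x ((p : ℂ) + (q : ℂ) * Complex.I))
  | .valAdd x y z, s => PMF.pure (s.setVal x (s.val y + s.val z))
  | .valSub x y z, s => PMF.pure (s.setVal x (s.val y - s.val z))
  | .valMul x y z, s => PMF.pure (s.setVal x (s.val y * s.val z))
  | .valDiv x y z, s => PMF.pure (s.setVal x (s.val y / s.val z))
  | .valConj x y, s => PMF.pure (s.setVal x (star (s.val y)))
  | .valLoad x y, s => PMF.pure (s.setVal x (s.val (s.idx y)))
  | .valStore x y, s => PMF.pure (s.setVal (s.idx x) (s.val y))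
  | .uniform x y, s => (PMF.uniformOfFintype (Fin (s.idx y - 1 + 1))).map (fun v => s.setIdx x v)
  | .sampleRow x, s => (l2Sample (fun i => (l2norm (A i) : ℂ))).map (fun v => s.setIdx x v)
  | .sampleCol x y, s => (l2Sample (rowAt A (s.idx y))).map (fun v => s.setIdx x v)
  | .sampleVec x, s => (l2Sample b).map (fun v => s.setIdx x v)
  | .entry x y z, s => PMF.pure (s.setVal x (entryAt (rowAt A (s.idx y)) (s.idx z)))
  | .rowNorm x y, s => PMF.pure (s.setVal x (l2norm (rowAt A (s.idx y)) : ℂ))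
  | .matNorm x, s => PMF.pure (s.setVal x (frobNorm A : ℂ))
  | .vecEntry x y, s => PMF.pure (s.setVal x (entryAt b (s.idx y)))
  | .vecNorm x, s => PMF.pure (s.setVal x (l2norm b : ℂ))

/-- The tests: comparison of two index cells, or of the real parts of two value cells. -/
inductive Test
  | idxLt (x y : ℕ)
  | valLt (x y : ℕ)

/-- When a test succeeds. -/
def Test.holds : Test → Mem → Prop
  | .idxLt x y, s => s.idx x < s.idx y
  | .valLt x y, s => (s.val x).re < (s.val y).re

/-- Programs. -/
inductive Prog
  | skip
  | instr (i : Instr)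
  | seq (p q : Prog)
  | ite (t : Test) (p q : Prog)
  | loop (t : Test) (p : Prog)

/-- A configuration: the programs that remain to be run, in this order, the memory, and the number
of queries made so far. The machine has halted when nothing remains to be run. -/
structure Config where
  todo : List Prog
  mem : Mem
  queries : ℕ

open Classical in
/-- One step (one unit of time) of a computation: one instruction, one test, or one move of the
control. A halted machine stays as it is. -/
noncomputable def Config.step {m n : ℕ} (A : Matrix (Fin m) (Fin n) ℂ) (b : Fin m → ℂ) :
    Config → PMF Config
  | ⟨[], s, c⟩ => PMF.pure ⟨[], s, c⟩
  | ⟨.skip :: K, s, c⟩ => PMF.pure ⟨K, s, c⟩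
  | ⟨.instr i :: K, s, c⟩ => (i.exec A b s).map (fun s' => ⟨K, s', c + i.queries⟩)
  | ⟨.seq p q :: K, s, c⟩ => PMF.pure ⟨p :: q :: K, s, c⟩
  | ⟨.ite t p q :: K, s, c⟩ => PMF.pure ⟨(if t.holds s then p else q) :: K, s, c⟩
  | ⟨.loop t p :: K, s, c⟩ => PMF.pure ⟨if t.holds s then p :: .loop t p :: K else K, s, c⟩

/-- The distribution of the configuration after `T` steps. -/
noncomputable def Config.run {m n : ℕ} (A : Matrix (Fin m) (Fin n) ℂ) (b : Fin m → ℂ) :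
    ℕ → Config → PMF Config
  | 0, c => PMF.pure c
  | T + 1, c => (c.step A b).bind (Config.run A b T)

/-- The initial configuration: the program is given the dimensions `m`, `n`, the index `i`, the
rank, the condition number, and the parameters `ε` and `δ`; all other cells are zero. -/
noncomputable def Config.init {m n : ℕ} (prog : Prog) (A : Matrix (Fin m) (Fin n) ℂ) (i : Fin n)
    (ε δ : ℝ) : Config where
  todo := [prog]
  mem :=
    { idx := fun
        | 0 => m
        | 1 => n
        | 2 => i
        | 3 => A.rank
        | _ => 0
      val := fun
        | 0 => (condNumber A : ℂ)
        | 1 => (ε : ℂ)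
        | 2 => (δ : ℂ)
        | _ => 0 }
  queries := 0

/-!
The algorithm is stochastic gradient descent for the least squares problem `min ‖A x - b‖`, followed
by an amplification of the success probability that costs only a factor linear in `log (1 / δ)`.

**Descent.** The iterate `x` is kept implicitly, as a combination of conjugated rows of `A`. A step
samples a row `r` with probability `‖A r‖² / ‖A‖_F²` and a column `j` from `D_{A r}`, and adds
`θ (b r / ‖A r‖² - x j / conj (A r j))` times the conjugate of row `r`. The entry `x j` is computed
exactly from the stored combination, in time proportional to the number of steps made so far. The
expected update is `(θ / ‖A‖_F²) Aᴴ (b - A x)`, and its second moment is at most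
`θ² (2 ‖b‖² / ‖A‖_F² + 2 ‖x‖²)`. The error `x - A⁻¹ b` always lies in the row space, where
`‖A e‖ ≥ σ_min ‖e‖`. Hence, with `S = 1 + k κ² ≥ ‖A‖_F² / σ_min²` and `θ ≤ 1 / (4 S)`, the
expected squared error `y` satisfies `y' ≤ (1 - θ / S) y + 6 S (‖b‖² / ‖A‖_F²) θ²`
(`sum_step_le`). A small `θ = 1 / D` and `D²` steps, with `D` polynomial in the parameters, make
the final expected squared error at most `(ε / 4)² / 16` (`descent_error_le`). So an independent
run yields a number `z` within `ε / 4` of the target with probability at least `15 / 16`.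

**Amplification.** Sorting the results of many runs to find a median would take more than linear time.
Instead, an estimate `μ` performs a walk: after each run it moves by a fixed `h` towards `z`, in the
real and in the imaginary direction. Far from the target, a move goes in the right direction with
probability at least `15 / 16`, so the potential `2 ^ (|μ - target| / h)` shrinks by the factor `5 / 8`
in expectation, up to an additive term (`walkPotential_nudge_le`). With `h = ε / (4 w)` and
`2 ^ (-w) ≤ δ / 32`, Markov's inequality bounds the failure probability by `δ` once the initial
potential has decayed, which takes a number of rounds linear in `w` (`walk_error_le`).

**Semantics.** Both arguments bound the expectation of a potential along the execution. Programs are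
therefore specified by `Bnd`, an upper bound for the expected value of a function of the final memory
together with a worst-case bound for the running time. It has one rule for each program construct; in
the loop rule `Bnd.loop` the invariant is itself a potential. Deterministic fragments are specified
by `Det`.
-/

open scoped ENNReal

/-! ### Expectations of extended nonnegative functions -/

/-- The expectation of an `ℝ≥0∞`-valued function under a probability mass function. -/
noncomputable def PMF.expect {α : Type*} (μ : PMF α) (f : α → ℝ≥0∞) : ℝ≥0∞ := ∑' a, μ a * f a

namespace PMF

variable {α β : Type*}

theorem expect_pure (a : α) (f : α → ℝ≥0∞) : (PMF.pure a).expect f = f a := by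
  unfold expect
  rw [tsum_eq_single a]
  · simp
  · intro b hb
    simp [hb]

theorem expect_bind (μ : PMF α) (κ : α → PMF β) (f : β → ℝ≥0∞) :
    (μ.bind κ).expect f = μ.expect fun a => (κ a).expect f := by
  unfold expect
  simp only [PMF.bind_apply, ← ENNReal.tsum_mul_right, ← ENNReal.tsum_mul_left]
  rw [ENNReal.tsum_comm]
  simp only [mul_assoc]

theorem expect_map (μ : PMF α) (g : α → β) (f : β → ℝ≥0∞) :
    (μ.map g).expect f = μ.expect fun a => f (g a) := by
  rw [← PMF.bind_pure_comp, expect_bind]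
  simp only [Function.comp, expect_pure]

theorem expect_mono (μ : PMF α) {f g : α → ℝ≥0∞} (h : ∀ a ∈ μ.support, f a ≤ g a) :
    μ.expect f ≤ μ.expect g := by
  refine ENNReal.tsum_le_tsum fun a => ?_
  by_cases ha : a ∈ μ.support
  · exact mul_le_mul_right (h a ha) _
  · rw [PMF.mem_support_iff, not_not] at ha
    simp [ha]

theorem expect_const (μ : PMF α) (c : ℝ≥0∞) : (μ.expect fun _ => c) = c := by
  unfold expect
  rw [ENNReal.tsum_mul_right, μ.tsum_coe, one_mul]

theorem expect_affine (μ : PMF α) (x y : ℝ≥0∞) (f : α → ℝ≥0∞) :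
    (μ.expect fun a => x + y * f a) = x + y * μ.expect f := by
  have h : (μ.expect fun a => x + y * f a) = (μ.expect fun _ => x) + y * μ.expect f := by
    unfold expect
    rw [← ENNReal.tsum_mul_left, ← ENNReal.tsum_add]
    exact tsum_congr fun a => by ring
  rw [h, expect_const]

/-- A function that takes the value `⊤` on some outcome has infinite expectation. -/
theorem ne_top_of_expect_ne_top (μ : PMF α) {f : α → ℝ≥0∞} (h : μ.expect f ≠ ⊤) {a : α}
    (ha : a ∈ μ.support) : f a ≠ ⊤ := by
  intro hf
  refine h (top_le_iff.1 ?_)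
  refine le_trans ?_ (ENNReal.le_tsum a)
  rw [hf, ENNReal.mul_top ((μ.mem_support_iff a).1 ha)]

end PMF

/-! ### Expected costs of programs -/

section Semantics

variable {m n : ℕ} (A : Matrix (Fin m) (Fin n) ℂ) (b : Fin m → ℂ)

open Classical in
/-- The value of `f` in the final memory; a computation that has not halted costs `⊤`. A finite
expectation of `haltCost f` therefore certifies that the machine has halted on every path. -/
noncomputable def haltCost (f : Mem → ℝ≥0∞) (c : Config) : ℝ≥0∞ :=
  if c.todo = [] then f c.mem else ⊤

/-- `Bnd A b p t s f v`: started in memory `s`, the program `p` halts within `t` steps on every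
path, and the expectation of `f` in the resulting memory is at most `v`. This is phrased for an
arbitrary continuation `K`, so that it composes: if running `K` from any `s'` has expected final
cost at most `f s'`, then running `p` followed by `K` from `s` has expected final cost at most
`v`. -/
def Bnd (p : Prog) (t : ℕ) (s : Mem) (f : Mem → ℝ≥0∞) (v : ℝ≥0∞) : Prop :=
  ∀ (K : List Prog) (T : ℕ) (h : Mem → ℝ≥0∞),
    (∀ s' q, (Config.run A b T ⟨K, s', q⟩).expect (haltCost h) ≤ f s') →
      ∀ q, (Config.run A b (t + T) ⟨p :: K, s, q⟩).expect (haltCost h) ≤ v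

/-- `Det A b p t s s'`: started in memory `s`, the program `p` halts within `t` steps in the
memory `s'`, on every path. -/
def Det (p : Prog) (t : ℕ) (s s' : Mem) : Prop := ∀ f, Bnd A b p t s f (f s')

variable {A b}

theorem expect_step_haltCost_le (h : Mem → ℝ≥0∞) (c : Config) :
    (c.step A b).expect (haltCost h) ≤ haltCost h c := by
  obtain ⟨_ | ⟨p, K⟩, s, q⟩ := c
  · simp [Config.step, PMF.expect_pure]
  · simp [haltCost]

theorem expect_run_succ_le (h : Mem → ℝ≥0∞) (T : ℕ) (c : Config) :
    (c.run A b (T + 1)).expect (haltCost h) ≤ (c.run A b T).expect (haltCost h) := by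
  induction T generalizing c with
  | zero =>
    simp only [Config.run, PMF.bind_pure, PMF.expect_pure]
    exact expect_step_haltCost_le h c
  | succ T ih =>
    rw [Config.run, PMF.expect_bind, Config.run, PMF.expect_bind]
    exact PMF.expect_mono _ fun c' _ => ih c'

theorem expect_run_antitone (h : Mem → ℝ≥0∞) (c : Config) :
    Antitone fun T => (c.run A b T).expect (haltCost h) :=
  antitone_nat_of_succ_le fun T => expect_run_succ_le h T c

namespace Bnd

theorem of_top (p : Prog) (t : ℕ) (s : Mem) (f : Mem → ℝ≥0∞) : Bnd A b p t s f ⊤ :=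
  fun _ _ _ _ _ => le_top

theorem mono {p : Prog} {t t' : ℕ} {s : Mem} {f f' : Mem → ℝ≥0∞} {v v' : ℝ≥0∞}
    (h : Bnd A b p t s f v) (ht : t ≤ t') (hf : ∀ s', f' s' ≤ f s') (hv : v ≤ v') :
    Bnd A b p t' s f' v' := fun K T g hg q =>
  (expect_run_antitone g _ (Nat.add_le_add_right ht T)).trans
    ((h K T g (fun s' q' => (hg s' q').trans (hf s')) q).trans hv)

theorem skip (s : Mem) (f : Mem → ℝ≥0∞) : Bnd A b .skip 1 s f (f s) := by
  intro K T h hK q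
  rw [Nat.add_comm, Config.run, Config.step, PMF.pure_bind]
  exact hK s q

theorem instr (i : Instr) (s : Mem) (f : Mem → ℝ≥0∞) :
    Bnd A b (.instr i) 1 s f ((i.exec A b s).expect f) := by
  intro K T h hK q
  rw [Nat.add_comm, Config.run, Config.step, PMF.expect_bind, PMF.expect_map]
  exact PMF.expect_mono _ fun s' _ => hK s' _

theorem seq {p p' : Prog} {t t' : ℕ} {s : Mem} {f g : Mem → ℝ≥0∞} {v : ℝ≥0∞}
    (h : Bnd A b p t s g v) (h' : ∀ s', Bnd A b p' t' s' f (g s')) :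
    Bnd A b (.seq p p') (t + t' + 1) s f v := by
  intro K T c hK q
  rw [show t + t' + 1 + T = (t + (t' + T)) + 1 by ring, Config.run, Config.step, PMF.pure_bind]
  exact h _ _ c (fun s' q' => h' s' K T c hK q') q

/-- The rule for a random instruction: `v` is drawn from `μ` and written to index cell `x`. -/
theorem sample_seq {i : Instr} {μ : PMF ℕ} {x t : ℕ} {s : Mem} {p : Prog} {f : Mem → ℝ≥0∞}
    {g : ℕ → ℝ≥0∞} (hi : i.exec A b s = μ.map fun v => s.setIdx x v)
    (h : ∀ v, Bnd A b p t (s.setIdx x v) f (g v)) :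
    Bnd A b (.seq (.instr i) p) (t + 2) s f (μ.expect g) := by
  intro K T c hK q
  rw [show t + 2 + T = t + T + 1 + 1 by ring, Config.run, Config.step, PMF.pure_bind, Config.run,
    Config.step, PMF.expect_bind, PMF.expect_map, hi, PMF.expect_map]
  exact PMF.expect_mono _ fun v _ => h v K T c hK _

theorem ite_pos {τ : Test} {p p' : Prog} {t : ℕ} {s : Mem} {f : Mem → ℝ≥0∞} {v : ℝ≥0∞}
    (hτ : τ.holds s) (h : Bnd A b p t s f v) : Bnd A b (.ite τ p p') (t + 1) s f v := by
  intro K T c hK q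
  rw [show t + 1 + T = t + T + 1 by ring, Config.run, Config.step, PMF.pure_bind, if_pos hτ]
  exact h K T c hK q

theorem ite_neg {τ : Test} {p p' : Prog} {t : ℕ} {s : Mem} {f : Mem → ℝ≥0∞} {v : ℝ≥0∞}
    (hτ : ¬ τ.holds s) (h : Bnd A b p' t s f v) : Bnd A b (.ite τ p p') (t + 1) s f v := by
  intro K T c hK q
  rw [show t + 1 + T = t + T + 1 by ring, Config.run, Config.step, PMF.pure_bind, if_neg hτ]
  exact h K T c hK q

theorem loop_exit {τ : Test} {p : Prog} {s : Mem} (f : Mem → ℝ≥0∞) (hτ : ¬ τ.holds s) :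
    Bnd A b (.loop τ p) 1 s f (f s) := by
  intro K T c hK q
  rw [Nat.add_comm, Config.run, Config.step, PMF.pure_bind, if_neg hτ]
  exact hK s q

theorem loop_enter {τ : Test} {p : Prog} {t t' : ℕ} {s : Mem} {f g : Mem → ℝ≥0∞} {v : ℝ≥0∞}
    (hτ : τ.holds s) (h : Bnd A b p t s g v) (h' : ∀ s', Bnd A b (.loop τ p) t' s' f (g s')) :
    Bnd A b (.loop τ p) (t + t' + 1) s f v := by
  intro K T c hK q
  rw [show t + t' + 1 + T = (t + (t' + T)) + 1 by ring, Config.run, Config.step, PMF.pure_bind,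
    if_pos hτ]
  exact h _ _ c (fun s' q' => h' s' K T c hK q') q

/-- The rule for a loop with `k` rounds left: `I k` bounds the expected final cost. Memories
violating the loop invariant are those where `I k` is `⊤`, and nothing is asked of them. -/
theorem loop {τ : Test} {p : Prog} {t : ℕ} {f : Mem → ℝ≥0∞} (I : ℕ → Mem → ℝ≥0∞)
    (h0 : ∀ s, I 0 s ≠ ⊤ → ¬ τ.holds s ∧ f s ≤ I 0 s)
    (h1 : ∀ k s, I (k + 1) s ≠ ⊤ → τ.holds s ∧ Bnd A b p t s (I k) (I (k + 1) s))
    (k : ℕ) (s : Mem) : Bnd A b (.loop τ p) (k * (t + 1) + 1) s f (I k s) := by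
  induction k generalizing s with
  | zero =>
    by_cases hs : I 0 s = ⊤
    · rw [hs]; exact of_top _ _ _ _
    · exact (loop_exit f (h0 s hs).1).mono (by simp) (fun _ => le_rfl) (h0 s hs).2
  | succ k ih =>
    by_cases hs : I (k + 1) s = ⊤
    · rw [hs]; exact of_top _ _ _ _
    · obtain ⟨hτ, hb⟩ := h1 k s hs
      exact (loop_enter hτ hb ih).mono (le_of_eq (by ring)) (fun _ => le_rfl) le_rfl

end Bnd

namespace Det

theorem mono {p : Prog} {t t' : ℕ} {s s' : Mem} (h : Det A b p t s s') (ht : t ≤ t') :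
    Det A b p t' s s' :=
  fun f => (h f).mono ht (fun _ => le_rfl) le_rfl

theorem bnd_seq {p p' : Prog} {t t' : ℕ} {s s' : Mem} {f : Mem → ℝ≥0∞} {v : ℝ≥0∞}
    (h : Det A b p t s s') (h' : Bnd A b p' t' s' f v) :
    Bnd A b (.seq p p') (t + t' + 1) s f v := by
  intro K T c hK q
  rw [show t + t' + 1 + T = (t + (t' + T)) + 1 by ring, Config.run, Config.step, PMF.pure_bind]
  -- the supremum removes the dependence of the continuation's cost on the query counter
  have := h (fun x => ⨆ q, (Config.run A b (t' + T) ⟨p' :: K, x, q⟩).expect (haltCost c)) (p' :: K)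
    (t' + T) c (fun x q => le_iSup
      (fun q => (Config.run A b (t' + T) ⟨p' :: K, x, q⟩).expect (haltCost c)) q) q
  exact this.trans (iSup_le fun q => h' K T c hK q)

theorem seq {p p' : Prog} {t t' : ℕ} {s s' s'' : Mem}
    (h : Det A b p t s s') (h' : Det A b p' t' s' s'') :
    Det A b (.seq p p') (t + t' + 1) s s'' :=
  fun f => h.bnd_seq (h' f)

theorem ite_pos {τ : Test} {p p' : Prog} {t : ℕ} {s s' : Mem}
    (hτ : τ.holds s) (h : Det A b p t s s') : Det A b (.ite τ p p') (t + 1) s s' :=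
  fun f => .ite_pos hτ (h f)

theorem ite_neg {τ : Test} {p p' : Prog} {t : ℕ} {s s' : Mem}
    (hτ : ¬ τ.holds s) (h : Det A b p' t s s') : Det A b (.ite τ p p') (t + 1) s s' :=
  fun f => .ite_neg hτ (h f)

theorem loop_exit {τ : Test} {p : Prog} {s : Mem} (hτ : ¬ τ.holds s) :
    Det A b (.loop τ p) 1 s s := fun f => .loop_exit f hτ

theorem loop_enter {τ : Test} {p : Prog} {t t' : ℕ} {s s' s'' : Mem} (hτ : τ.holds s)
    (h : Det A b p t s s') (h' : Det A b (.loop τ p) t' s' s'') :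
    Det A b (.loop τ p) (t + t' + 1) s s'' := by
  have h2 := h.seq h'
  intro f K T c hK q
  have h3 := h2 f K T c hK q
  rw [show t + t' + 1 + T = (t + t' + T) + 1 by ring] at h3 ⊢
  simp only [Config.run, Config.step, PMF.pure_bind, if_pos hτ] at h3 ⊢
  exact h3

/-- The rule for a deterministic loop with `k` rounds left and invariant `I`. -/
theorem loop {τ : Test} {p : Prog} {t : ℕ} (I : ℕ → Mem → Prop)
    (h0 : ∀ s, I 0 s → ¬ τ.holds s)
    (h1 : ∀ k s, I (k + 1) s → τ.holds s ∧ ∃ s', Det A b p t s s' ∧ I k s')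
    (k : ℕ) (s : Mem) (hs : I k s) :
    ∃ s', Det A b (.loop τ p) (k * (t + 1) + 1) s s' ∧ I 0 s' := by
  induction k generalizing s with
  | zero => exact ⟨s, (loop_exit (h0 s hs)).mono (by simp), hs⟩
  | succ k ih =>
    obtain ⟨hτ, s', hp, hs'⟩ := h1 k s hs
    obtain ⟨s'', hl, hs''⟩ := ih s' hs'
    exact ⟨s'', (loop_enter hτ hp hl).mono (le_of_eq (by ring)), hs''⟩

end Det

/-- The program that executes a list of instructions in order. -/
def Prog.block : List Instr → Prog
  | [] => .skip
  | i :: l => .seq (.instr i) (.block l)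

/-- The effect of an instruction that uses no randomness (the random ones, for which the value is
irrelevant, leave the memory as it is). -/
noncomputable def Instr.next (A : Matrix (Fin m) (Fin n) ℂ) (b : Fin m → ℂ) : Instr → Mem → Mem
  | .idxConst x c, s => s.setIdx x c
  | .idxAdd x y z, s => s.setIdx x (s.idx y + s.idx z)
  | .idxSub x y z, s => s.setIdx x (s.idx y - s.idx z)
  | .idxLoad x y, s => s.setIdx x (s.idx (s.idx y))
  | .idxStore x y, s => s.setIdx (s.idx x) (s.idx y)
  | .valConst x p q, s => s.setVal x ((p : ℂ) + (q : ℂ) * Complex.I)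
  | .valAdd x y z, s => s.setVal x (s.val y + s.val z)
  | .valSub x y z, s => s.setVal x (s.val y - s.val z)
  | .valMul x y z, s => s.setVal x (s.val y * s.val z)
  | .valDiv x y z, s => s.setVal x (s.val y / s.val z)
  | .valConj x y, s => s.setVal x (star (s.val y))
  | .valLoad x y, s => s.setVal x (s.val (s.idx y))
  | .valStore x y, s => s.setVal (s.idx x) (s.val y)
  | .entry x y z, s => s.setVal x (entryAt (rowAt A (s.idx y)) (s.idx z))
  | .rowNorm x y, s => s.setVal x (l2norm (rowAt A (s.idx y)) : ℂ)
  | .matNorm x, s => s.setVal x (frobNorm A : ℂ)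
  | .vecEntry x y, s => s.setVal x (entryAt b (s.idx y))
  | .vecNorm x, s => s.setVal x (l2norm b : ℂ)
  | _, s => s

/-- Whether an instruction uses no randomness. -/
def Instr.isDet : Instr → Bool
  | .uniform _ _ | .sampleRow _ | .sampleCol _ _ | .sampleVec _ => false
  | _ => true

theorem Instr.exec_eq_pure {i : Instr} (hi : i.isDet = true) (s : Mem) :
    i.exec A b s = PMF.pure (i.next A b s) := by
  cases i <;> first | rfl | simp [Instr.isDet] at hi

theorem Det.instr {i : Instr} (hi : i.isDet = true) (s : Mem) :
    Det A b (.instr i) 1 s (i.next A b s) := by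
  intro f
  have := Bnd.instr (A := A) (b := b) i s f
  rwa [Instr.exec_eq_pure hi, PMF.expect_pure] at this

theorem Det.block (l : List Instr) (hl : l.all Instr.isDet = true) (s : Mem) :
    Det A b (.block l) (2 * l.length + 1) s (l.foldl (fun s i => i.next A b s) s) := by
  induction l generalizing s with
  | nil => exact fun f => Bnd.skip s f
  | cons i l ih =>
    simp only [List.all_cons, Bool.and_eq_true] at hl
    refine ((Det.instr hl.1 s).seq (ih hl.2 _)).mono (le_of_eq ?_)
    simp only [List.length_cons]
    ring

/-- At most one query is made per unit of time. -/
theorem queries_le_of_mem_support_run (T : ℕ) (c c' : Config)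
    (hc : c' ∈ (c.run A b T).support) : c'.queries ≤ c.queries + T := by
  induction T generalizing c with
  | zero =>
    simp only [Config.run, PMF.support_pure, Set.mem_singleton_iff] at hc
    simp [hc]
  | succ T ih =>
    simp only [Config.run, PMF.mem_support_bind_iff] at hc
    obtain ⟨c₁, h₁, h₂⟩ := hc
    refine (ih c₁ h₂).trans ?_
    suffices c₁.queries ≤ c.queries + 1 by omega
    obtain ⟨_ | ⟨p, K⟩, s, q⟩ := c
    · simp only [Config.step, PMF.support_pure, Set.mem_singleton_iff] at h₁
      simp [h₁]
    · cases p
      case instr i =>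
        simp only [Config.step, PMF.mem_support_map_iff] at h₁
        obtain ⟨s', -, rfl⟩ := h₁
        cases i <;> simp [Instr.queries]
      all_goals
        simp only [Config.step, PMF.support_pure, Set.mem_singleton_iff] at h₁
        simp [h₁]

/-- From an expected cost to the two guarantees for a complete run: halting on every path, and a
small probability of the bad event. -/
theorem Bnd.run_init {p : Prog} {T : ℕ} {s : Mem} {good : Mem → Prop} {δ : ℝ} (hδ : 0 ≤ δ)
    (h : Bnd A b p T s (fun s' => open Classical in if good s' then 0 else 1)
      (ENNReal.ofReal δ)) :
    (∀ c ∈ (Config.run A b T ⟨[p], s, 0⟩).support, c.todo = [] ∧ c.queries ≤ T) ∧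
      ENNReal.ofReal (1 - δ) ≤ (Config.run A b T ⟨[p], s, 0⟩).toOuterMeasure
        {c | c.todo = [] ∧ good c.mem} := by
  classical
  set μ := Config.run A b T ⟨[p], s, 0⟩ with hμ
  have hle := h [] 0 (fun s' => if good s' then 0 else 1) (fun s' q => by
    simp only [Config.run, PMF.expect_pure, haltCost, if_true]
    exact le_of_eq (by congr)) 0
  rw [Nat.add_zero, ← hμ] at hle
  refine ⟨fun c hc => ⟨?_, ?_⟩, ?_⟩
  · have := μ.ne_top_of_expect_ne_top (hle.trans_lt ENNReal.ofReal_lt_top).ne hc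
    by_contra hne
    exact this (by simp [haltCost, hne])
  · simpa using queries_le_of_mem_support_run T _ c hc
  · rw [PMF.toOuterMeasure_apply]
    set E := {c : Config | c.todo = [] ∧ good c.mem}
    have h1 : (1 : ℝ≥0∞) ≤ ∑' c, E.indicator μ c + ENNReal.ofReal δ := by
      refine le_trans ?_ (add_le_add_right hle _)
      rw [PMF.expect, ← ENNReal.tsum_add, ← μ.tsum_coe]
      refine ENNReal.tsum_le_tsum fun c => ?_
      by_cases hcE : c ∈ E
      · simp [Set.indicator_of_mem hcE]
      · rw [Set.indicator_of_notMem hcE, zero_add]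
        refine le_mul_of_one_le_right' ?_
        by_cases hc0 : c.todo = []
        · have : ¬ good c.mem := fun hg => hcE ⟨hc0, hg⟩
          simp [haltCost, hc0, this]
        · simp [haltCost, hc0]
    rw [ENNReal.ofReal_sub _ hδ, ENNReal.ofReal_one]
    exact tsub_le_iff_right.2 h1

end Semantics

/-! ### Singular values and the pseudo-inverse -/

section SingularValues

variable {m n : ℕ} (A : Matrix (Fin m) (Fin n) ℂ)

theorem l2norm_eq_norm (v : Fin n → ℂ) : l2norm v = ‖WithLp.toLp 2 v‖ := by
  rw [EuclideanSpace.norm_eq]; rfl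

theorem l2norm_nonneg (v : Fin n → ℂ) : 0 ≤ l2norm v := Real.sqrt_nonneg _

theorem sq_l2norm (v : Fin n → ℂ) : l2norm v ^ 2 = ∑ j, ‖v j‖ ^ 2 :=
  Real.sq_sqrt (Finset.sum_nonneg fun _ _ => by positivity)

theorem frobNorm_nonneg : 0 ≤ frobNorm A := Real.sqrt_nonneg _

theorem sq_frobNorm : frobNorm A ^ 2 = ∑ i, ∑ j, ‖A i j‖ ^ 2 :=
  Real.sq_sqrt (Finset.sum_nonneg fun _ _ => Finset.sum_nonneg fun _ _ => by positivity)

theorem sq_frobNorm_eq_sum_rows : frobNorm A ^ 2 = ∑ i, l2norm (A i) ^ 2 := by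
  simp only [sq_frobNorm, sq_l2norm]

/-- The right singular vectors, an orthonormal basis. -/
noncomputable def rightSingularBasis :
    OrthonormalBasis (Fin (Module.finrank ℂ (EuclideanSpace ℂ (Fin n)))) ℂ
      (EuclideanSpace ℂ (Fin n)) :=
  (Matrix.toEuclideanLin A).isSymmetric_adjoint_comp_self.eigenvectorBasis rfl

theorem adjoint_apply_rightSingularBasis (l : Fin (Module.finrank ℂ (EuclideanSpace ℂ (Fin n)))) :
    (Matrix.toEuclideanLin A).adjoint (Matrix.toEuclideanLin A (rightSingularBasis A l)) =
      (((Matrix.toEuclideanLin A).singularValues l ^ 2 : ℝ) : ℂ) • rightSingularBasis A l := by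
  rw [(Matrix.toEuclideanLin A).sq_singularValues_fin rfl]
  exact (Matrix.toEuclideanLin A).isSymmetric_adjoint_comp_self.apply_eigenvectorBasis rfl l

theorem sq_norm_apply_eq_sum_singularValues (x : EuclideanSpace ℂ (Fin n)) :
    ‖Matrix.toEuclideanLin A x‖ ^ 2 =
      ∑ l : Fin (Module.finrank ℂ (EuclideanSpace ℂ (Fin n))),
        (Matrix.toEuclideanLin A).singularValues l ^ 2 *
      ‖inner ℂ (rightSingularBasis A l) x‖ ^ 2 := by
  set T := Matrix.toEuclideanLin A
  have h1 : ((‖T x‖ ^ 2 : ℝ) : ℂ) = inner ℂ x (T.adjoint (T x)) := by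
    rw [LinearMap.adjoint_inner_right, inner_self_eq_norm_sq_to_K, Complex.ofReal_pow]; rfl
  have h2 : T.adjoint (T x) = ∑ l : Fin (Module.finrank ℂ (EuclideanSpace ℂ (Fin n))),
      (inner ℂ (rightSingularBasis A l) x *
      ((T.singularValues l ^ 2 : ℝ) : ℂ)) • rightSingularBasis A l := by
    conv_lhs => rw [← (rightSingularBasis A).sum_repr' x]
    simp only [map_sum, map_smul]
    refine Finset.sum_congr rfl fun l _ => ?_
    rw [adjoint_apply_rightSingularBasis, smul_smul]
  apply Complex.ofReal_injective
  rw [h1, h2, inner_sum]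
  push_cast
  refine Finset.sum_congr rfl fun l _ => ?_
  rw [inner_smul_right, ← Complex.conj_mul', inner_conj_symm]
  ring

theorem norm_apply_rightSingularBasis (l : Fin (Module.finrank ℂ (EuclideanSpace ℂ (Fin n)))) :
    ‖Matrix.toEuclideanLin A (rightSingularBasis A l)‖ =
      (Matrix.toEuclideanLin A).singularValues l := by
  rw [← sq_eq_sq₀ (norm_nonneg _) (LinearMap.singularValues_nonneg _ _),
    sq_norm_apply_eq_sum_singularValues, Finset.sum_eq_single l]
  · simp
  · intro j _ hj
    rw [(rightSingularBasis A).inner_eq_zero hj]; simp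
  · simp

theorem sq_frobNorm_eq_sum_singularValues :
    frobNorm A ^ 2 = ∑ l : Fin (Module.finrank ℂ (EuclideanSpace ℂ (Fin n))),
      (Matrix.toEuclideanLin A).singularValues l ^ 2 := by
  set T := Matrix.toEuclideanLin A
  have h : ∀ l : Fin (Module.finrank ℂ (EuclideanSpace ℂ (Fin n))), T.singularValues l ^ 2 =
      ∑ i, ‖inner ℂ (rightSingularBasis A l) (T.adjoint (EuclideanSpace.single i 1))‖ ^ 2 := by
    intro l
    rw [← norm_apply_rightSingularBasis, EuclideanSpace.norm_sq_eq]
    refine Finset.sum_congr rfl fun i _ => ?_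
    rw [LinearMap.adjoint_inner_right, EuclideanSpace.inner_single_right]
    simp [T]
  have h' : ∀ i, ∑ l, ‖inner ℂ (rightSingularBasis A l)
      (T.adjoint (EuclideanSpace.single i 1))‖ ^ 2 = ∑ j, ‖A i j‖ ^ 2 := by
    intro i
    rw [OrthonormalBasis.sum_sq_norm_inner_right, EuclideanSpace.norm_sq_eq]
    refine Finset.sum_congr rfl fun j _ => ?_
    rw [← Matrix.toEuclideanLin_conjTranspose_eq_adjoint]
    simp [Matrix.toLpLin_apply, Matrix.toEuclideanLin]
  simp only [h]
  rw [Finset.sum_comm, sq_frobNorm]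
  exact Finset.sum_congr rfl fun i _ => (h' i).symm

theorem singularValues_le_specNorm
    (l : Fin (Module.finrank ℂ (EuclideanSpace ℂ (Fin n)))) :
    (Matrix.toEuclideanLin A).singularValues l ≤ specNorm A := by
  rw [← norm_apply_rightSingularBasis]
  have := Matrix.l2_opNorm_mulVec A (rightSingularBasis A l)
  rw [(rightSingularBasis A).norm_eq_one, mul_one] at this
  exact this

theorem rank_eq_finrank_range_toEuclideanLin :
    A.rank = Module.finrank ℂ (Matrix.toEuclideanLin A).range := by
  rw [show Matrix.toEuclideanLin A = Matrix.toLin (PiLp.basisFun 2 ℂ (Fin n))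
    (PiLp.basisFun 2 ℂ (Fin m)) A by rw [← Matrix.toLpLin_eq_toLin]]
  exact Matrix.rank_eq_finrank_range_toLin A _ _

theorem sq_frobNorm_le_rank_mul : frobNorm A ^ 2 ≤ A.rank * specNorm A ^ 2 := by
  rw [sq_frobNorm_eq_sum_singularValues, rank_eq_finrank_range_toEuclideanLin]
  set T := Matrix.toEuclideanLin A
  set r := Module.finrank ℂ T.range
  calc _ = ∑ l : Fin (Module.finrank ℂ (EuclideanSpace ℂ (Fin n))) with l.1 < r,
        T.singularValues l ^ 2 := by
        rw [Finset.sum_filter]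
        refine Finset.sum_congr rfl fun l _ => ?_
        split_ifs with h
        · rfl
        · rw [LinearMap.singularValues_eq_zero_iff_le_finrank_range _ |>.2 (not_lt.1 h)]; simp
    _ ≤ ∑ l : Fin (Module.finrank ℂ (EuclideanSpace ℂ (Fin n))) with l.1 < r,
        specNorm A ^ 2 := by
        refine Finset.sum_le_sum fun l _ => ?_
        exact pow_le_pow_left₀ (LinearMap.singularValues_nonneg _ _)
          (singularValues_le_specNorm A l) 2
    _ ≤ _ := by
        rw [Finset.sum_const, nsmul_eq_mul]
        refine mul_le_mul_of_nonneg_right ?_ (sq_nonneg _)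
        have : Finset.card {l : Fin (Module.finrank ℂ (EuclideanSpace ℂ (Fin n))) | l.1 < r}
            ≤ (Finset.range r).card :=
          Finset.card_le_card_of_injOn Fin.val (by intro l; simp) (Fin.val_injective.injOn)
        rw [Finset.card_range] at this
        exact_mod_cast this

variable {A}

theorem sigmaMin_pos (hA : A ≠ 0) : 0 < sigmaMin A := by
  obtain ⟨h0, l, hl⟩ := (isLeast_sigmaMin A hA).1
  rw [hl] at h0 ⊢
  exact ((Matrix.toEuclideanLin A).singularValues_pos_iff_ne_zero l).2 h0

theorem frobNorm_pos (hA : A ≠ 0) : 0 < frobNorm A := by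
  refine Real.sqrt_pos.2 (lt_of_le_of_ne
    (Finset.sum_nonneg fun _ _ => Finset.sum_nonneg fun _ _ => by positivity) fun h => hA ?_)
  ext i j
  have h1 := (Finset.sum_eq_zero_iff_of_nonneg
    (fun _ _ => Finset.sum_nonneg fun _ _ => by positivity)).1 h.symm i (Finset.mem_univ _)
  have h2 := (Finset.sum_eq_zero_iff_of_nonneg (fun _ _ => by positivity)).1 h1 j
    (Finset.mem_univ _)
  simpa using h2

theorem specNorm_nonneg (A : Matrix (Fin m) (Fin n) ℂ) : 0 ≤ specNorm A := by
  unfold specNorm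
  rw [Matrix.l2_opNorm_def]
  exact norm_nonneg _

theorem specNorm_pos (hA : A ≠ 0) : 0 < specNorm A := by
  refine lt_of_le_of_ne (specNorm_nonneg A) fun h => ?_
  have h1 := sq_frobNorm_le_rank_mul A
  have h2 := frobNorm_pos hA
  rw [← h] at h1
  nlinarith

theorem specNorm_le_frobNorm : specNorm A ≤ frobNorm A := by
  unfold specNorm
  rw [Matrix.l2_opNorm_def]
  refine ContinuousLinearMap.opNorm_le_bound _ (frobNorm_nonneg A) fun x => ?_
  refine le_of_sq_le_sq ?_ (by have := frobNorm_nonneg A; positivity)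
  have h := sq_norm_apply_eq_sum_singularValues A x
  have e : (LinearMap.toContinuousLinearMap (Matrix.toEuclideanLin A)) x
    = Matrix.toEuclideanLin A x := rfl
  have : ‖Matrix.toEuclideanLin A x‖ ^ 2 ≤ (frobNorm A * ‖x‖) ^ 2 := by
    rw [h, mul_pow, sq_frobNorm_eq_sum_singularValues, Finset.sum_mul]
    refine Finset.sum_le_sum fun l _ => mul_le_mul_of_nonneg_left ?_ (sq_nonneg _)
    rw [← (rightSingularBasis A).sum_sq_norm_inner_right x]
    exact Finset.single_le_sum (f := fun l => ‖inner ℂ (rightSingularBasis A l) x‖ ^ 2)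
      (fun _ _ => by positivity) (Finset.mem_univ l)
  exact this

/-- On the row space, `A` is bounded below by its minimum nonzero singular value. -/
theorem sigmaMin_mul_le_of_rowSpace (hA : A ≠ 0) (u : Fin m → ℂ) :
    sigmaMin A ^ 2 * l2norm (A.conjTranspose.mulVec u) ^ 2 ≤
      l2norm (A.mulVec (A.conjTranspose.mulVec u)) ^ 2 := by
  set T := Matrix.toEuclideanLin A
  have hx : WithLp.toLp 2 (A.conjTranspose.mulVec u) = T.adjoint (WithLp.toLp 2 u) := by
    rw [← Matrix.toEuclideanLin_conjTranspose_eq_adjoint]; rfl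
  have hTx : l2norm (A.mulVec (A.conjTranspose.mulVec u)) =
      ‖T (WithLp.toLp 2 (A.conjTranspose.mulVec u))‖ := by
    rw [l2norm_eq_norm]; rfl
  rw [hTx, sq_norm_apply_eq_sum_singularValues, l2norm_eq_norm,
    ← (rightSingularBasis A).sum_sq_norm_inner_right, Finset.mul_sum]
  refine Finset.sum_le_sum fun l _ => ?_
  by_cases hl : T.singularValues l = 0
  · have h0 : T (rightSingularBasis A l) = 0 := by
      rw [← norm_eq_zero, norm_apply_rightSingularBasis]; exact hl
    rw [hx, LinearMap.adjoint_inner_right, h0]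
    simp
  · refine mul_le_mul_of_nonneg_right ?_ (sq_nonneg _)
    exact pow_le_pow_left₀ (sigmaMin_pos hA).le ((isLeast_sigmaMin A hA).2 ⟨hl, l, rfl⟩) 2

variable (A)

/-- The normal equations: `A⁻¹ b` is a least squares solution. -/
theorem conjTranspose_mul_mul_pinv : A.conjTranspose * (A * pinv A) = A.conjTranspose := by
  obtain ⟨h1, -, h3, -⟩ := pinv_penrose A
  calc A.conjTranspose * (A * pinv A) = A.conjTranspose * (A * pinv A).conjTranspose := by
        rw [h3.eq]
    _ = A.conjTranspose := by rw [← Matrix.conjTranspose_mul, h1]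

/-- The pseudo-inverse maps into the row space. -/
theorem pinv_eq_conjTranspose_mul :
    pinv A = A.conjTranspose * ((pinv A).conjTranspose * pinv A) := by
  obtain ⟨-, h2, -, h4⟩ := pinv_penrose A
  conv_lhs => rw [← h2, ← h4.eq, Matrix.conjTranspose_mul, Matrix.mul_assoc]

theorem l2norm_mulVec_pinv_le (b : Fin m → ℂ) :
    l2norm (A.mulVec ((pinv A).mulVec b)) ≤ l2norm b := by
  obtain ⟨h1, -, h3, -⟩ := pinv_penrose A
  set P := A * pinv A with hP
  have hPP : P.conjTranspose * P = P := by
    rw [h3.eq, hP, ← Matrix.mul_assoc, h1]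
  have key : inner ℂ (WithLp.toLp 2 (P.mulVec b)) (WithLp.toLp 2 (P.mulVec b)) =
      inner ℂ (WithLp.toLp 2 (P.mulVec b)) (WithLp.toLp 2 b) := by
    have e : ∀ w : Fin m → ℂ, inner ℂ (WithLp.toLp 2 (P.mulVec b)) (WithLp.toLp 2 w) =
        inner ℂ (WithLp.toLp 2 b) (WithLp.toLp 2 (P.conjTranspose.mulVec w)) := by
      intro w
      change inner ℂ (Matrix.toEuclideanLin P (WithLp.toLp 2 b)) _ =
        inner ℂ _ (Matrix.toEuclideanLin P.conjTranspose (WithLp.toLp 2 w))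
      rw [Matrix.toEuclideanLin_conjTranspose_eq_adjoint, LinearMap.adjoint_inner_right]
    rw [e, e, Matrix.mulVec_mulVec, hPP, h3.eq]
  rw [Matrix.mulVec_mulVec, ← hP, l2norm_eq_norm, l2norm_eq_norm]
  have h5 := norm_inner_le_norm (𝕜 := ℂ) (WithLp.toLp 2 (P.mulVec b)) (WithLp.toLp 2 b)
  rw [← key, inner_self_eq_norm_sq_to_K] at h5
  simp only [norm_pow, Complex.coe_algebraMap, Complex.norm_real, norm_norm] at h5
  by_contra hlt
  push Not at hlt
  have := norm_nonneg (WithLp.toLp 2 b)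
  nlinarith

variable {A}

theorem sigmaMin_mul_l2norm_pinv_le (hA : A ≠ 0) (b : Fin m → ℂ) :
    sigmaMin A ^ 2 * l2norm ((pinv A).mulVec b) ^ 2 ≤ l2norm b ^ 2 := by
  have h := sigmaMin_mul_le_of_rowSpace hA (((pinv A).conjTranspose * pinv A).mulVec b)
  rw [Matrix.mulVec_mulVec, ← pinv_eq_conjTranspose_mul] at h
  exact h.trans (pow_le_pow_left₀ (l2norm_nonneg _) (l2norm_mulVec_pinv_le A b) 2)

theorem condNumber_nonneg (A : Matrix (Fin m) (Fin n) ℂ) (hA : A ≠ 0) : 0 ≤ condNumber A :=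
  div_nonneg (specNorm_nonneg A) (sigmaMin_pos hA).le

/-- The ratio `‖A‖_F² / σ_min²` governs the convergence of the iteration; it is at most `k κ²`. -/
theorem sq_frobNorm_le_rank_mul_condNumber (hA : A ≠ 0) :
    frobNorm A ^ 2 ≤ A.rank * condNumber A ^ 2 * sigmaMin A ^ 2 := by
  have h := (sigmaMin_pos hA).ne'
  have : condNumber A ^ 2 * sigmaMin A ^ 2 = specNorm A ^ 2 := by
    unfold condNumber; field_simp
  rw [mul_assoc, this]
  exact sq_frobNorm_le_rank_mul A

end SingularValues

/-! ### One step of stochastic gradient descent -/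

section Step

variable {m n : ℕ}

theorem l2norm_pos_of_ne_zero {v : Fin n → ℂ} (hv : v ≠ 0) : 0 < l2norm v := by
  rw [l2norm_eq_norm, norm_pos_iff]
  intro h
  exact hv (by simpa using congrArg WithLp.ofLp h)

theorem norm_le_l2norm (v : Fin n → ℂ) (j : Fin n) : ‖v j‖ ≤ l2norm v := by
  rw [l2norm_eq_norm]
  exact PiLp.norm_apply_le (WithLp.toLp 2 v) j

theorem expect_l2Sample {v : Fin n → ℂ} (hv : v ≠ 0) (g : ℕ → ℝ≥0∞) :
    (l2Sample v).expect g = ∑ j, ENNReal.ofReal (‖v j‖ ^ 2 / l2norm v ^ 2) * g j := by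
  unfold l2Sample
  rw [dif_neg hv, PMF.expect_map, PMF.expect, tsum_fintype]
  rfl

theorem expect_l2Sample_ofReal {v : Fin n → ℂ} (hv : v ≠ 0) {g : ℕ → ℝ} (hg : ∀ j, 0 ≤ g j) :
    ((l2Sample v).expect fun j => ENNReal.ofReal (g j)) =
      ENNReal.ofReal (∑ j : Fin n, ‖v j‖ ^ 2 / l2norm v ^ 2 * g j) := by
  rw [expect_l2Sample hv, ENNReal.ofReal_sum_of_nonneg]
  swap
  · exact fun j _ => mul_nonneg (by positivity) (hg j)
  exact Finset.sum_congr rfl fun j _ => (ENNReal.ofReal_mul (by positivity)).symm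

theorem sq_l2norm_add_smul (e a : Fin n → ℂ) (c : ℂ) :
    l2norm (fun l => e l + c * star (a l)) ^ 2 =
      l2norm e ^ 2 + 2 * (star (∑ l, a l * e l) * c).re + ‖c‖ ^ 2 * l2norm a ^ 2 := by
  simp only [sq_l2norm, star_sum, Finset.sum_mul, Complex.re_sum, Finset.mul_sum,
    ← Finset.sum_add_distrib]
  refine Finset.sum_congr rfl fun l _ => ?_
  simp only [Complex.sq_norm, Complex.normSq_apply, Complex.star_def, Complex.add_re,
    Complex.add_im, Complex.mul_re, Complex.mul_im, Complex.conj_re, Complex.conj_im, map_mul]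
  ring

/-- The coefficient of the update along row `r`, with its inner product with the current iterate
`x` estimated from the single entry `j`. Out of range indices stand for zero entries. -/
noncomputable def stepCoeff (A : Matrix (Fin m) (Fin n) ℂ) (b : Fin m → ℂ) (θ : ℝ)
    (x : Fin n → ℂ) (r j : ℕ) : ℂ :=
  (entryAt b r / ((l2norm (rowAt A r) : ℂ) * (l2norm (rowAt A r) : ℂ)) -
    entryAt x j / star (entryAt (rowAt A r) j)) * θ

/-- One step of the iteration, for the sampled row `r` and column `j`. -/
noncomputable def stepIter (A : Matrix (Fin m) (Fin n) ℂ) (b : Fin m → ℂ) (θ : ℝ)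
    (x : Fin n → ℂ) (r j : ℕ) : Fin n → ℂ :=
  fun l => x l + stepCoeff A b θ x r j * star (rowAt A r l)

theorem entryAt_val (v : Fin n → ℂ) (j : Fin n) : entryAt v j = v j := by
  simp [entryAt]

theorem rowAt_val (A : Matrix (Fin m) (Fin n) ℂ) (r : Fin m) : rowAt A r = A r := by
  simp [rowAt]

/-- The estimator of `⟨A r, x⟩ / ‖A r‖²` from one sampled column: it is unbiased. -/
theorem sum_sample_estimator {a : Fin n → ℂ} (ha : a ≠ 0) (x : Fin n → ℂ) (β : ℂ) :
    ∑ j, ((‖a j‖ ^ 2 / l2norm a ^ 2 : ℝ) : ℂ) *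
        (β / ((l2norm a : ℂ) * (l2norm a : ℂ)) - x j / star (a j)) =
      (β - ∑ j, a j * x j) / ((l2norm a ^ 2 : ℝ) : ℂ) := by
  have hn : ((l2norm a : ℝ) : ℂ) ≠ 0 := by exact_mod_cast (l2norm_pos_of_ne_zero ha).ne'
  have h1 : ∀ j, ((‖a j‖ ^ 2 / l2norm a ^ 2 : ℝ) : ℂ) *
      (β / ((l2norm a : ℂ) * (l2norm a : ℂ)) - x j / star (a j)) =
      ((‖a j‖ ^ 2 : ℝ) : ℂ) * (β / (l2norm a : ℂ) ^ 4) - a j * x j / (l2norm a : ℂ) ^ 2 := by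
    intro j
    by_cases hj : a j = 0
    · simp [hj]
    have hs : star (a j) ≠ 0 := by simpa using hj
    have h2 : ((‖a j‖ ^ 2 : ℝ) : ℂ) = a j * star (a j) := by
      rw [Complex.star_def, Complex.mul_conj']; push_cast; rfl
    rw [Complex.ofReal_div, h2]
    push_cast
    field_simp
  simp only [h1]
  rw [Finset.sum_sub_distrib, ← Finset.sum_mul, ← Complex.ofReal_sum, ← sq_l2norm,
    ← Finset.sum_div]
  push_cast
  field_simp

/-- The second moment of the same estimator. -/
theorem sum_sample_sq_estimator_le {a : Fin n → ℂ} (ha : a ≠ 0) (x : Fin n → ℂ) (β : ℂ) :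
    ∑ j, (‖a j‖ ^ 2 / l2norm a ^ 2) *
        ‖β / ((l2norm a : ℂ) * (l2norm a : ℂ)) - x j / star (a j)‖ ^ 2 ≤
      2 * ‖β‖ ^ 2 / l2norm a ^ 4 + 2 * l2norm x ^ 2 / l2norm a ^ 2 := by
  have hn := l2norm_pos_of_ne_zero ha
  have h1 : ∀ j, (‖a j‖ ^ 2 / l2norm a ^ 2) *
        ‖β / ((l2norm a : ℂ) * (l2norm a : ℂ)) - x j / star (a j)‖ ^ 2 ≤
      ‖a j‖ ^ 2 * (2 * ‖β‖ ^ 2 / l2norm a ^ 6) + ‖x j‖ ^ 2 * (2 / l2norm a ^ 2) := by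
    intro j
    have h2 : ‖β / ((l2norm a : ℂ) * (l2norm a : ℂ)) - x j / star (a j)‖ ^ 2 ≤
        2 * (‖β‖ / l2norm a ^ 2) ^ 2 + 2 * (‖x j‖ / ‖a j‖) ^ 2 := by
      have h3 := norm_sub_le (β / ((l2norm a : ℂ) * (l2norm a : ℂ))) (x j / star (a j))
      rw [norm_div, norm_div, norm_mul, Complex.norm_real, Real.norm_of_nonneg hn.le, norm_star,
        ← sq (l2norm a)] at h3
      have h4 := pow_le_pow_left₀ (norm_nonneg _) h3 2
      nlinarith [sq_nonneg (‖β‖ / l2norm a ^ 2 - ‖x j‖ / ‖a j‖)]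
    by_cases hj : a j = 0
    · rw [hj]
      have : 0 ≤ ‖x j‖ ^ 2 * (2 / l2norm a ^ 2) := by positivity
      simpa using this
    have hj' : 0 < ‖a j‖ := norm_pos_iff.2 hj
    refine (mul_le_mul_of_nonneg_left h2 (by positivity)).trans (le_of_eq ?_)
    field_simp
  refine (Finset.sum_le_sum fun j _ => h1 j).trans (le_of_eq ?_)
  rw [Finset.sum_add_distrib, ← Finset.sum_mul, ← Finset.sum_mul, ← sq_l2norm, ← sq_l2norm]
  field_simp

/-- The contribution of the row `r` to the expected squared error after a step: the previous error, the
gradient term and the second moment of the update. For a zero row the left-hand side is zero. -/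
theorem sum_row_step_le (A : Matrix (Fin m) (Fin n) ℂ) (b : Fin m → ℂ) {θ : ℝ}
    (x z : Fin n → ℂ) (hA : A ≠ 0) (r : Fin m) :
    l2norm (A r) ^ 2 / frobNorm A ^ 2 * ∑ j : Fin n, ‖A r j‖ ^ 2 / l2norm (A r) ^ 2 *
        l2norm (fun l => stepIter A b θ x r j l - z l) ^ 2 ≤
      l2norm (A r) ^ 2 / frobNorm A ^ 2 * l2norm (fun l => x l - z l) ^ 2 +
      2 * θ / frobNorm A ^ 2 *
        (star (A.mulVec (fun l => x l - z l) r) * (b r - A.mulVec x r)).re +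
      θ ^ 2 * (2 * ‖b r‖ ^ 2 / frobNorm A ^ 2 +
        2 * l2norm x ^ 2 * (l2norm (A r) ^ 2 / frobNorm A ^ 2)) := by
  have hF := frobNorm_pos hA
  by_cases ha : A r = 0
  · have h0 : ∀ y : Fin n → ℂ, A.mulVec y r = 0 := fun y => by
      simp [Matrix.mulVec, ha]
    have h1 : l2norm (A r) = 0 := by rw [ha]; simp [l2norm]
    rw [h0, h1]
    simp only [star_zero, zero_mul, Complex.zero_re, mul_zero, ne_eq, OfNat.ofNat_ne_zero,
      not_false_eq_true, zero_pow, zero_div, add_zero, zero_add]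
    positivity
  have hn := l2norm_pos_of_ne_zero ha
  set e : Fin n → ℂ := fun l => x l - z l with he
  set w : Fin n → ℂ := fun j =>
    b r / ((l2norm (A r) : ℂ) * (l2norm (A r) : ℂ)) - x j / star (A r j) with hw
  have hstep : ∀ j : Fin n, l2norm (fun l => stepIter A b θ x r j l - z l) ^ 2 =
      l2norm e ^ 2 + 2 * θ * (star (A.mulVec e r) * w j).re +
        θ ^ 2 * l2norm (A r) ^ 2 * ‖w j‖ ^ 2 := by
    intro j
    have : (fun l => stepIter A b θ x r j l - z l) =
        fun l => e l + (w j * θ) * star (A r l) := by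
      funext l
      simp only [stepIter, stepCoeff, entryAt_val, rowAt_val, he, hw]
      ring
    rw [this, sq_l2norm_add_smul, norm_mul, Complex.norm_real, mul_pow, Real.norm_eq_abs, sq_abs,
      ← mul_assoc, Complex.re_mul_ofReal]
    change l2norm e ^ 2 + 2 * ((star (A.mulVec e r) * w j).re * θ) + _ = _
    ring
  have hsum1 : ∑ j, ‖A r j‖ ^ 2 / l2norm (A r) ^ 2 = 1 := by
    rw [← Finset.sum_div, ← sq_l2norm, div_self (by positivity)]
  have hlin : ∑ j, ‖A r j‖ ^ 2 / l2norm (A r) ^ 2 * (star (A.mulVec e r) * w j).re =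
      (star (A.mulVec e r) * (b r - A.mulVec x r)).re / l2norm (A r) ^ 2 := by
    have h := congrArg (fun c => (star (A.mulVec e r) * c).re) (sum_sample_estimator ha x (b r))
    simp only [Finset.mul_sum, Complex.re_sum] at h
    rw [← Complex.div_ofReal_re, mul_div_assoc]
    refine Eq.trans (Finset.sum_congr rfl fun j _ => ?_) h
    rw [← Complex.re_ofReal_mul]
    congr 1
    simp only [hw]
    ring
  have hq := sum_sample_sq_estimator_le ha x (b r)
  change ∑ j, _ * ‖w j‖ ^ 2 ≤ _ at hq
  have htot : ∑ j : Fin n, ‖A r j‖ ^ 2 / l2norm (A r) ^ 2 *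
        l2norm (fun l => stepIter A b θ x r j l - z l) ^ 2 ≤
      l2norm e ^ 2 + 2 * θ *
        ((star (A.mulVec e r) * (b r - A.mulVec x r)).re / l2norm (A r) ^ 2) +
      θ ^ 2 * l2norm (A r) ^ 2 *
        (2 * ‖b r‖ ^ 2 / l2norm (A r) ^ 4 + 2 * l2norm x ^ 2 / l2norm (A r) ^ 2) := by
    rw [← hlin]
    refine le_trans (le_of_eq ?_) (add_le_add_right (mul_le_mul_of_nonneg_left hq (by positivity)) _)
    conv_rhs => rw [← one_mul (l2norm e ^ 2), ← hsum1]
    simp only [Finset.sum_mul, Finset.mul_sum, ← Finset.sum_add_distrib]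
    refine Finset.sum_congr rfl fun j _ => ?_
    rw [hstep]
    ring
  refine (mul_le_mul_of_nonneg_left htot (by positivity)).trans (le_of_eq ?_)
  field_simp

/-- In expectation, one step contracts the squared distance to the least squares solution, up to a
noise term. The contraction needs the error `x - A⁻¹ b` to lie in the row space. -/
theorem sum_step_le (A : Matrix (Fin m) (Fin n) ℂ) (b : Fin m → ℂ) {θ S : ℝ} (hA : A ≠ 0)
    (x : Fin n → ℂ) (u : Fin m → ℂ) (hx : x = A.conjTranspose.mulVec u)
    (hS1 : 1 ≤ S) (hS : frobNorm A ^ 2 ≤ S * sigmaMin A ^ 2) (hθ : 0 ≤ θ) (hθS : 4 * S * θ ≤ 1) :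
    ∑ r, l2norm (A r) ^ 2 / frobNorm A ^ 2 * ∑ j : Fin n, ‖A r j‖ ^ 2 / l2norm (A r) ^ 2 *
        l2norm (fun l => stepIter A b θ x r j l - (pinv A).mulVec b l) ^ 2 ≤
      (1 - θ / S) * l2norm (fun l => x l - (pinv A).mulVec b l) ^ 2 +
        6 * S * (l2norm b ^ 2 / frobNorm A ^ 2) * θ ^ 2 := by
  have hF := frobNorm_pos hA
  have hσ := sigmaMin_pos hA
  set z := (pinv A).mulVec b with hz
  set e : Fin n → ℂ := fun l => x l - z l with he
  have hee : e = x - z := rfl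
  refine (Finset.sum_le_sum fun r _ => sum_row_step_le A b x z hA r).trans ?_
  rw [Finset.sum_add_distrib, Finset.sum_add_distrib, ← Finset.sum_mul, ← Finset.mul_sum,
    ← Finset.mul_sum, Finset.sum_add_distrib, ← Finset.mul_sum, ← Finset.sum_div,
    ← Finset.sum_div, ← Finset.mul_sum, ← sq_frobNorm_eq_sum_rows, ← sq_l2norm,
    div_self (by positivity), ← Complex.re_sum, ← he]
  -- the gradient term, by the normal equations
  have hgrad : ∑ r, star (A.mulVec e r) * (b r - A.mulVec x r) =
      -((l2norm (A.mulVec e) ^ 2 : ℝ) : ℂ) := by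
    have h1 : ∑ r, star (A.mulVec e r) * (b r - A.mulVec z r) = 0 := by
      have : star (A.mulVec e) ⬝ᵥ (b - A.mulVec z) = 0 := by
        rw [Matrix.star_mulVec, ← Matrix.dotProduct_mulVec, Matrix.mulVec_sub, hz,
          Matrix.mulVec_mulVec, Matrix.mulVec_mulVec, Matrix.mul_assoc,
          conjTranspose_mul_mul_pinv, sub_self,
          dotProduct_zero]
      exact this
    have h2 : ∑ r, star (A.mulVec e r) * A.mulVec e r = ((l2norm (A.mulVec e) ^ 2 : ℝ) : ℂ) := by
      rw [sq_l2norm, Complex.ofReal_sum]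
      refine Finset.sum_congr rfl fun r _ => ?_
      rw [Complex.star_def, Complex.conj_mul']
      push_cast; rfl
    rw [← h2, ← zero_sub, ← h1, ← Finset.sum_sub_distrib]
    refine Finset.sum_congr rfl fun r _ => ?_
    have : A.mulVec e r = A.mulVec x r - A.mulVec z r := by
      rw [hee, Matrix.mulVec_sub]; rfl
    rw [this]
    ring
  rw [hgrad, Complex.neg_re, Complex.ofReal_re]
  -- the error lies in the row space, where `A` is bounded below
  have hAe : sigmaMin A ^ 2 * l2norm e ^ 2 ≤ l2norm (A.mulVec e) ^ 2 := by
    have : e = A.conjTranspose.mulVec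
        (u - ((pinv A).conjTranspose * pinv A).mulVec b) := by
      rw [Matrix.mulVec_sub, Matrix.mulVec_mulVec, ← pinv_eq_conjTranspose_mul, hee, hx]
    rw [this]
    exact sigmaMin_mul_le_of_rowSpace hA _
  have hAe' : 1 / S * l2norm e ^ 2 ≤ l2norm (A.mulVec e) ^ 2 / frobNorm A ^ 2 := by
    rw [le_div_iff₀ (by positivity)]
    refine le_trans ?_ hAe
    rw [one_div, mul_assoc, inv_mul_le_iff₀ (by positivity)]
    nlinarith [sq_nonneg (l2norm e)]
  have hzn : l2norm z ^ 2 ≤ S * (l2norm b ^ 2 / frobNorm A ^ 2) := by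
    have h := sigmaMin_mul_l2norm_pinv_le hA b
    rw [← mul_div_assoc, le_div_iff₀ (by positivity)]
    nlinarith [mul_le_mul_of_nonneg_right hS (sq_nonneg (l2norm z))]
  have hxn : l2norm x ^ 2 ≤ 2 * l2norm e ^ 2 + 2 * l2norm z ^ 2 := by
    simp only [sq_l2norm, Finset.mul_sum, ← Finset.sum_add_distrib]
    refine Finset.sum_le_sum fun l _ => ?_
    have h1 : ‖x l‖ ≤ ‖e l‖ + ‖z l‖ := by
      have := norm_add_le (e l) (z l)
      rwa [show e l + z l = x l by simp [he]] at this
    nlinarith [norm_nonneg (x l), sq_nonneg (‖e l‖ - ‖z l‖), pow_le_pow_left₀ (norm_nonneg _) h1 2]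
  set Y := l2norm (A.mulVec e) ^ 2 / frobNorm A ^ 2 with hY
  set B := l2norm b ^ 2 / frobNorm A ^ 2 with hB
  have hB0 : 0 ≤ B := by positivity
  have e1 : 2 * θ / frobNorm A ^ 2 * -l2norm (A.mulVec e) ^ 2 = -(2 * θ * Y) := by rw [hY]; ring
  have e2 : 2 * l2norm b ^ 2 / frobNorm A ^ 2 = 2 * B := by rw [hB]; ring
  rw [e1, e2, one_mul, mul_one]
  have hθ2 : 4 * θ ^ 2 ≤ θ / S := by
    rw [le_div_iff₀ (by positivity)]; nlinarith
  have h1 : 2 * θ * (1 / S * l2norm e ^ 2) ≤ 2 * θ * Y :=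
    mul_le_mul_of_nonneg_left hAe' (by positivity)
  have h2 : 2 * θ * (1 / S * l2norm e ^ 2) = 2 * (θ / S * l2norm e ^ 2) := by ring
  have h3 : 4 * θ ^ 2 * l2norm e ^ 2 ≤ θ / S * l2norm e ^ 2 :=
    mul_le_mul_of_nonneg_right hθ2 (sq_nonneg _)
  have h4 : θ ^ 2 * (2 * B + 2 * l2norm x ^ 2) ≤
      θ ^ 2 * (6 * (S * B) + 4 * l2norm e ^ 2) := by
    refine mul_le_mul_of_nonneg_left ?_ (sq_nonneg _)
    nlinarith
  nlinarith

/-- `sum_step_le` in terms of the sampling queries. -/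
theorem expect_step_le (A : Matrix (Fin m) (Fin n) ℂ) (b : Fin m → ℂ) {θ S : ℝ} (hA : A ≠ 0)
    (x : Fin n → ℂ) (u : Fin m → ℂ) (hx : x = A.conjTranspose.mulVec u)
    (hS1 : 1 ≤ S) (hS : frobNorm A ^ 2 ≤ S * sigmaMin A ^ 2) (hθ : 0 ≤ θ) (hθS : 4 * S * θ ≤ 1) :
    ((l2Sample fun i => (l2norm (A i) : ℂ)).expect fun r => (l2Sample (rowAt A r)).expect fun j =>
        ENNReal.ofReal (l2norm (fun l => stepIter A b θ x r j l - (pinv A).mulVec b l) ^ 2)) ≤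
      ENNReal.ofReal ((1 - θ / S) * l2norm (fun l => x l - (pinv A).mulVec b l) ^ 2 +
        6 * S * (l2norm b ^ 2 / frobNorm A ^ 2) * θ ^ 2) := by
  have hF := frobNorm_pos hA
  have hv : l2norm (fun i => (l2norm (A i) : ℂ)) ^ 2 = frobNorm A ^ 2 := by
    rw [sq_l2norm, sq_frobNorm_eq_sum_rows]
    exact Finset.sum_congr rfl fun i _ => by
      rw [Complex.norm_real, Real.norm_of_nonneg (l2norm_nonneg _)]
  have hv0 : (fun i => (l2norm (A i) : ℂ)) ≠ 0 := by
    intro h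
    rw [h] at hv
    have : l2norm (0 : Fin m → ℂ) = 0 := by simp [l2norm]
    rw [this] at hv
    nlinarith
  refine le_trans (le_of_eq ?_)
    (ENNReal.ofReal_le_ofReal (sum_step_le A b hA x u hx hS1 hS hθ hθS))
  rw [expect_l2Sample hv0, ENNReal.ofReal_sum_of_nonneg (fun r _ => mul_nonneg (by positivity)
    (Finset.sum_nonneg fun j _ => by positivity))]
  refine Finset.sum_congr rfl fun r _ => ?_
  rw [hv, Complex.norm_real, Real.norm_of_nonneg (l2norm_nonneg _),
    ENNReal.ofReal_mul (by positivity)]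
  by_cases ha : A r = 0
  · simp [ha, l2norm]
  · congr 1
    rw [rowAt_val, expect_l2Sample_ofReal ha (fun j => by positivity)]

end Step

/-! ### The program -/

/-!
The memory layout. Index cells: `2` holds the index `i`, `3` the rank (counted down during the setup), `4` and `5` the
constants `1` and `0`, `6` the end of the arrays, `7` and `8` the current row and column; `9` and `10`
are scratch. Value cells: `0` holds the current estimate, `1` and `2` hold `ε` and `δ`, `3` and `4` hold
`-i` and `h i`, `5` to `8` hold `S`, `D`, `D²` and `1 / D`, `9` holds `1`, `10` the step `h` of the walk,
`11` the number `D w` of rounds, `12` and `13` count rounds and steps, `14` holds the entry of the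
iterate, and `15` to `19` are scratch. The arrays start at `100` in both kinds of cells. -/

/-- Stores `x(j)` in value cell `14`, where `j` is in index cell `8` and `x` is the current
iterate. The iterate is a combination of conjugated rows of `A`: the row indices and the coefficients
are kept in the index and value cells from `100` on, up to the address held in index cell `6`. -/
def iterateEntryProg : Prog :=
  .seq (.block [.valConst 14 0 0, .idxConst 9 100])
    (.loop (.idxLt 9 6) (.block [.idxLoad 10 9, .entry 15 10 8, .valConj 15 15, .valLoad 16 9,
      .valMul 15 15 16, .valAdd 14 14 15, .idxAdd 9 9 4]))

/-- The deterministic part of a step of the iteration: appends the sampled row with its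
coefficient. -/
def appendProg : Prog :=
  .seq iterateEntryProg
    (.block [.valAdd 13 13 9, .entry 15 7 8, .valConj 15 15, .valDiv 14 14 15, .rowNorm 16 7,
      .valMul 16 16 16, .vecEntry 17 7, .valDiv 17 17 16, .valSub 17 17 14, .valMul 17 17 8,
      .idxStore 6 7, .valStore 6 17, .idxAdd 6 6 4])

/-- One step of stochastic gradient descent. -/
def stepProg : Prog :=
  .seq (.instr (.sampleRow 7)) (.seq (.instr (.sampleCol 8 7)) appendProg)

/-- A complete run of stochastic gradient descent, leaving entry `i` of the final iterate in value
cell `14`. -/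
def descentProg : Prog :=
  .seq (.block [.valConst 13 0 0, .idxConst 6 100])
    (.seq (.loop (.valLt 13 7) stepProg) (.seq (.block [.idxAdd 8 2 5]) iterateEntryProg))

/-- Moves the estimate in value cell `0` by `h` towards value cell `14`, in both coordinates. -/
def nudgeProg : Prog :=
  .seq (.ite (.valLt 0 14) (.block [.valAdd 0 0 10]) (.block [.valSub 0 0 10]))
    (.seq (.block [.valMul 15 0 3, .valMul 16 14 3])
      (.ite (.valLt 15 16) (.block [.valAdd 0 0 4]) (.block [.valSub 0 0 4])))

/-- One round of the amplification. -/
def roundProg : Prog :=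
  .seq (.block [.valAdd 12 12 9]) (.seq descentProg nudgeProg)

/-- The computation of the parameters. -/
def setupProg : Prog :=
  .seq (.block [.valConst 9 1 0, .valConst 5 1 0, .valMul 15 0 0, .idxConst 4 1])
  (.seq (.loop (.idxLt 5 3) (.block [.valAdd 5 5 15, .idxSub 3 3 4]))
  (.seq (.block [.matNorm 16, .vecNorm 17, .valDiv 16 17 16, .valDiv 16 16 1, .valMul 16 16 16,
      .valMul 16 16 5, .valAdd 16 16 9, .valMul 6 16 5, .valConst 17 4096 0, .valMul 6 6 17,
      .valMul 7 6 6, .valDiv 8 9 6, .valConst 18 1 0, .valConst 19 5 0, .valConst 17 (1 / 2) 0])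
  (.seq (.loop (.valLt 2 18) (.block [.valMul 18 18 17, .valAdd 19 19 9]))
    (.block [.valConst 17 (1 / 4) 0, .valMul 10 1 17, .valDiv 10 10 19, .valMul 11 6 19,
      .valConst 0 0 0, .valConst 12 0 0, .valConst 3 0 (-1), .valConst 17 0 1, .valMul 4 10 17]))))

/-- The whole algorithm. -/
def solverProg : Prog := .seq setupProg (.loop (.valLt 12 11) roundProg)

section Program

variable {m n : ℕ} {A : Matrix (Fin m) (Fin n) ℂ} {b : Fin m → ℂ}

/-- The iterate stored in the arrays, when they have length `t`. -/
noncomputable def iterate (A : Matrix (Fin m) (Fin n) ℂ) (s : Mem) (t : ℕ) : Fin n → ℂ :=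
  fun l => ∑ q ∈ Finset.range t, s.val (100 + q) * star (rowAt A (s.idx (100 + q)) l)

theorem entryAt_iterate (s : Mem) (t j : ℕ) :
    entryAt (iterate A s t) j =
      ∑ q ∈ Finset.range t, s.val (100 + q) * star (entryAt (rowAt A (s.idx (100 + q))) j) := by
  unfold entryAt
  split_ifs
  · rfl
  · simp

/-- The iterate is in the row space of `A`. -/
theorem exists_iterate_eq_conjTranspose_mulVec (s : Mem) (t : ℕ) :
    ∃ u : Fin m → ℂ, iterate A s t = A.conjTranspose.mulVec u := by
  induction t with
  | zero => exact ⟨0, by funext l; simp [iterate]⟩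
  | succ t ih =>
    obtain ⟨u, hu⟩ := ih
    have hsucc : iterate A s (t + 1) = iterate A s t +
        fun l => s.val (100 + t) * star (rowAt A (s.idx (100 + t)) l) := by
      funext l; simp [iterate, Finset.sum_range_succ]
    by_cases hr : s.idx (100 + t) < m
    · refine ⟨u + Pi.single ⟨_, hr⟩ (s.val (100 + t)), ?_⟩
      rw [Matrix.mulVec_add, ← hu, hsucc]
      congr 1
      funext l
      simp [rowAt, hr, mul_comm]
    · refine ⟨u, ?_⟩
      rw [hsucc, hu]
      funext l
      simp [rowAt, hr]

/-- The cells that hold parameters are unchanged. -/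
def Frame (s s' : Mem) : Prop :=
  (∀ x ≤ 5, s'.idx x = s.idx x) ∧ ∀ x ≤ 12, s'.val x = s.val x

theorem Frame.trans {s s' s'' : Mem} (h : Frame s s') (h' : Frame s' s'') : Frame s s'' :=
  ⟨fun x hx => (h'.1 x hx).trans (h.1 x hx), fun x hx => (h'.2 x hx).trans (h.2 x hx)⟩

theorem array_ne {c : ℕ} (hc : c < 100) (t : ℕ) : 100 + t ≠ c := by omega

theorem ne_array {c : ℕ} (hc : c < 100) (t : ℕ) : c ≠ 100 + t := by omega

theorem det_iterateEntry (s : Mem) (t : ℕ) (h4 : s.idx 4 = 1) (h6 : s.idx 6 = 100 + t) :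
    ∃ s', Det A b iterateEntryProg (16 * t + 7) s s' ∧
      s'.val 14 = entryAt (iterate A s t) (s.idx 8) ∧
      (∀ x, x ≠ 9 → x ≠ 10 → s'.idx x = s.idx x) ∧
      ∀ x, x ≠ 14 → x ≠ 15 → x ≠ 16 → s'.val x = s.val x := by
  set J : ℕ → Mem → Prop := fun k s' =>
    (∃ q, q + k = t ∧ s'.idx 9 = 100 + q ∧ s'.val 14 =
      ∑ q ∈ Finset.range q, s.val (100 + q) * star (entryAt (rowAt A (s.idx (100 + q))) (s.idx 8)))
    ∧ (∀ x, x ≠ 9 → x ≠ 10 → s'.idx x = s.idx x) ∧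
      ∀ x, x ≠ 14 → x ≠ 15 → x ≠ 16 → s'.val x = s.val x with hJ
  have hinit := Det.block (A := A) (b := b) [.valConst 14 0 0, .idxConst 9 100] rfl s
  obtain ⟨s', hdet, hs'⟩ := Det.loop (A := A) (b := b) (τ := .idxLt 9 6) (t := 15)
    (p := .block [.idxLoad 10 9, .entry 15 10 8, .valConj 15 15, .valLoad 16 9,
      .valMul 15 15 16, .valAdd 14 14 15, .idxAdd 9 9 4]) J (by
        rintro s' ⟨⟨q, hq, h9, -⟩, hi, -⟩
        simp only [Test.holds, h9, hi 6 (by decide) (by decide), h6]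
        omega) (by
        rintro k s' ⟨⟨q, hq, h9, h14⟩, hi, hv⟩
        refine ⟨?_, _, Det.block _ rfl _, ⟨q + 1, by omega, ?_, ?_⟩, ?_, ?_⟩
        · simp only [Test.holds, h9, hi 6 (by decide) (by decide), h6]
          omega
        · simp [Instr.next, Mem.setIdx, Mem.setVal, h9, hi 4 (by decide) (by decide), h4]
          omega
        · simp [Instr.next, Mem.setIdx, Mem.setVal, h9, h14, array_ne,
            hi 8 (by decide) (by decide), Finset.sum_range_succ,
            hi (100 + q) (by omega) (by omega),
            hv (100 + q) (by omega) (by omega) (by omega), mul_comm]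
        · intro x h1 h2
          simp [Instr.next, Mem.setIdx, Mem.setVal, Function.update_apply, h1, h2, hi x h1 h2]
        · intro x h1 h2 h3
          simp [Instr.next, Mem.setIdx, Mem.setVal, Function.update_apply, h1, h2, h3,
            hv x h1 h2 h3]) t
      ([Instr.valConst 14 0 0, .idxConst 9 100].foldl (fun s i => i.next A b s) s) (by
        refine ⟨⟨0, by omega, ?_, ?_⟩, ?_, ?_⟩
        · simp [Instr.next, Mem.setIdx, Mem.setVal]
        · simp [Instr.next, Mem.setIdx, Mem.setVal]
        · intro x h1 h2
          simp [Instr.next, Mem.setIdx, Mem.setVal, h1]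
        · intro x h1 h2 h3
          simp [Instr.next, Mem.setIdx, Mem.setVal, h1])
  obtain ⟨⟨q, hq, -, h14⟩, hi, hv⟩ := hs'
  obtain rfl : q = t := by omega
  refine ⟨s', (hinit.seq hdet).mono ?_, ?_, hi, hv⟩
  · simp only [List.length_cons, List.length_nil]; omega
  · rw [h14, entryAt_iterate]

theorem det_append (s : Mem) (t : ℕ) {θ : ℝ} (h4 : s.idx 4 = 1) (h6 : s.idx 6 = 100 + t)
    (h8 : s.val 8 = θ) (h9 : s.val 9 = 1) (h13 : s.val 13 = t) :
    ∃ s', Det A b appendProg (16 * t + 35) s s' ∧ Frame s s' ∧ s'.idx 6 = 100 + (t + 1) ∧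
      s'.val 13 = (t + 1 : ℕ) ∧
      iterate A s' (t + 1) = stepIter A b θ (iterate A s t) (s.idx 7) (s.idx 8) := by
  obtain ⟨s₁, hdet, h14, hi, hv⟩ := det_iterateEntry (A := A) (b := b) s t h4 h6
  refine ⟨_, (hdet.seq (Det.block _ rfl s₁)).mono ?_, ⟨?_, ?_⟩, ?_, ?_, ?_⟩
  · simp only [List.length_cons, List.length_nil]; omega
  · intro x hx
    have e1 : x ≠ 6 := by omega
    have e2 : x ≠ 100 + t := by omega
    simp [Instr.next, Mem.setIdx, Mem.setVal, ne_array, e1, e2,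
      hi 6 (by decide) (by decide), h6, hi x (by omega) (by omega)]
  · intro x hx
    have e1 : x ≠ 13 := by omega
    have e2 : x ≠ 14 := by omega
    have e3 : x ≠ 15 := by omega
    have e4 : x ≠ 16 := by omega
    have e5 : x ≠ 17 := by omega
    have e6 : x ≠ 100 + t := by omega
    simp [Instr.next, Mem.setIdx, Mem.setVal, ne_array, e1, e2, e3, e4, e5, e6,
      hi 6 (by decide) (by decide), h6, hv x (by omega) (by omega) (by omega)]
  · simp [Instr.next, Mem.setIdx, Mem.setVal, ne_array,
      hi 6 (by decide) (by decide), h6, hi 4 (by decide) (by decide), h4]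
    omega
  · simp [Instr.next, Mem.setIdx, Mem.setVal, ne_array,
      hi 6 (by decide) (by decide), h6, hv 13 (by decide) (by decide) (by decide), h13,
      hv 9 (by decide) (by decide) (by decide), h9]
  · funext l
    rw [stepIter, iterate, Finset.sum_range_succ]
    congr 1
    · refine Finset.sum_congr rfl fun q hq => ?_
      rw [Finset.mem_range] at hq
      have e1 : q ≠ t := by omega
      have f1 : 100 + q ≠ 6 := by omega
      simp [Instr.next, Mem.setIdx, Mem.setVal, array_ne, ne_array, e1, f1,
        hi 6 (by decide) (by decide), h6, hi (100 + q) (by omega) (by omega),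
        hv (100 + q) (by omega) (by omega) (by omega)]
    · simp [Instr.next, Mem.setIdx, Mem.setVal, array_ne, ne_array, stepCoeff,
        hi 6 (by decide) (by decide), h6, hi 7 (by decide) (by decide),
        hi 8 (by decide) (by decide), hv 8 (by decide) (by decide) (by decide), h8, h14]

/-! ### Analysis of a complete run of the descent -/

/-- The `k`-th iterate of `y ↦ a * y + c`. If a potential is multiplied by `a` and increased by `c` in
each step, in expectation, this is what remains of the value `y` after `k` steps. -/
noncomputable def affineIter (a c : ℝ) (k : ℕ) (y : ℝ) : ℝ :=
  a ^ k * y + c * ∑ l ∈ Finset.range k, a ^ l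

theorem affineIter_zero (a c y : ℝ) : affineIter a c 0 y = y := by simp [affineIter]

theorem affineIter_succ (a c : ℝ) (k : ℕ) (y : ℝ) :
    affineIter a c (k + 1) y = affineIter a c k (a * y + c) := by
  simp only [affineIter, Finset.sum_range_succ]
  ring

theorem affineIter_nonneg {a c : ℝ} (ha : 0 ≤ a) (hc : 0 ≤ c) (k : ℕ) {y : ℝ} (hy : 0 ≤ y) :
    0 ≤ affineIter a c k y :=
  add_nonneg (by positivity) (mul_nonneg hc (Finset.sum_nonneg fun _ _ => by positivity))

theorem affineIter_mono {a c : ℝ} (ha : 0 ≤ a) (k : ℕ) {y y' : ℝ} (h : y ≤ y') :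
    affineIter a c k y ≤ affineIter a c k y' := by
  unfold affineIter
  gcongr

theorem affineIter_le {a c : ℝ} (ha : 0 ≤ a) (ha1 : a < 1) (hc : 0 ≤ c) (k : ℕ) (y : ℝ) :
    affineIter a c k y ≤ a ^ k * y + c / (1 - a) := by
  unfold affineIter
  rw [div_eq_mul_inv, ← tsum_geometric_of_lt_one ha ha1]
  gcongr
  exact (summable_geometric_of_lt_one ha ha1).sum_le_tsum _ fun _ _ => by positivity

theorem iterate_congr {s s' : Mem} (t : ℕ) (hi : ∀ q, s'.idx (100 + q) = s.idx (100 + q))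
    (hv : ∀ q, s'.val (100 + q) = s.val (100 + q)) : iterate A s' t = iterate A s t := by
  unfold iterate
  simp only [hi, hv]

/-- The squared error of an iterate. -/
noncomputable def sqError (A : Matrix (Fin m) (Fin n) ℂ) (b : Fin m → ℂ) (x : Fin n → ℂ) : ℝ :=
  l2norm (fun l => x l - (pinv A).mulVec b l) ^ 2

/-- One step of the descent. The constants `α` and `β` serve to combine the squared error with a
function of the cells that the descent does not touch. -/
theorem bnd_step {S θ : ℝ} (hA : A ≠ 0) (hS1 : 1 ≤ S)
    (hS : frobNorm A ^ 2 ≤ S * sigmaMin A ^ 2) (hθ : 0 ≤ θ) (hθS : 4 * S * θ ≤ 1)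
    (k : ℕ) (α β : ℝ≥0∞) (s : Mem) (t : ℕ) (h4 : s.idx 4 = 1) (h6 : s.idx 6 = 100 + t)
    (h8 : s.val 8 = θ) (h9 : s.val 9 = 1) (h13 : s.val 13 = t) {a c : ℝ} (ha : a = 1 - θ / S)
    (hc : c = 6 * S * (l2norm b ^ 2 / frobNorm A ^ 2) * θ ^ 2) (f : Mem → ℝ≥0∞)
    (hf : ∀ s', Frame s s' → s'.idx 6 = 100 + (t + 1) → s'.val 13 = (t + 1 : ℕ) →
      f s' ≤ α + β * ENNReal.ofReal (affineIter a c k (sqError A b (iterate A s' (t + 1))))) :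
    Bnd A b stepProg (16 * t + 39) s f
      (α + β * ENNReal.ofReal (affineIter a c (k + 1) (sqError A b (iterate A s t)))) := by
  have ha0 : 0 ≤ a := by
    rw [ha, sub_nonneg, div_le_one (by positivity)]
    nlinarith
  have hc0 : 0 ≤ c := by rw [hc]; positivity
  set x := iterate A s t with hx
  have key : ∀ r j, Bnd A b appendProg (16 * t + 35) ((s.setIdx 7 r).setIdx 8 j) f
      (α + β * ENNReal.ofReal (affineIter a c k (sqError A b (stepIter A b θ x r j)))) := by
    intro r j
    obtain ⟨s', hdet, hfr, h6', h13', hit⟩ := det_append (A := A) (b := b)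
      ((s.setIdx 7 r).setIdx 8 j) t (θ := θ) (by simpa [Mem.setIdx] using h4)
      (by simpa [Mem.setIdx] using h6) h8 h9 h13
    have hit0 : iterate A ((s.setIdx 7 r).setIdx 8 j) t = x :=
      iterate_congr t (fun q => by simp [Mem.setIdx, array_ne]) fun q => rfl
    have hfr0 : Frame s ((s.setIdx 7 r).setIdx 8 j) := by
      refine ⟨fun y hy => ?_, fun y _ => rfl⟩
      have e1 : y ≠ 7 := by omega
      have e2 : y ≠ 8 := by omega
      simp [Mem.setIdx, e1, e2]
    refine (hdet f).mono le_rfl (fun _ => le_rfl) ?_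
    refine (hf s' (hfr0.trans hfr) h6' h13').trans (le_of_eq ?_)
    rw [hit, hit0]
    simp [Mem.setIdx]
  have hsplit : ∀ y, 0 ≤ y → α + β * ENNReal.ofReal (affineIter a c k y) =
      (α + β * ENNReal.ofReal (c * ∑ l ∈ Finset.range k, a ^ l)) +
        (β * ENNReal.ofReal (a ^ k)) * ENNReal.ofReal y := by
    intro y hy
    unfold affineIter
    rw [ENNReal.ofReal_add (by positivity)
      (mul_nonneg hc0 (Finset.sum_nonneg fun _ _ => by positivity)),
      ENNReal.ofReal_mul (by positivity)]
    ring
  have hnn : ∀ x, 0 ≤ sqError A b x := fun x => sq_nonneg _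
  have h := Bnd.sample_seq (A := A) (b := b) (i := .sampleRow 7) (s := s) rfl fun r =>
    Bnd.sample_seq (i := .sampleCol 8 7) (s := s.setIdx 7 r) rfl fun j => key r j
  refine h.mono (by omega) (fun _ => le_rfl) ?_
  simp only [hsplit _ (hnn _), PMF.expect_affine]
  obtain ⟨u, hu⟩ := exists_iterate_eq_conjTranspose_mulVec (A := A) s t
  have hstep := expect_step_le A b hA x u hu hS1 hS hθ hθS
  rw [← ha, ← hc] at hstep
  rw [affineIter_succ, hsplit _ (add_nonneg (mul_nonneg ha0 (hnn _)) hc0)]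
  refine add_le_add_right (mul_le_mul_right (le_trans (le_of_eq ?_) hstep) _) _
  simp [Mem.setIdx, sqError]

/-- A complete run of the descent with `⌈D₂⌉` steps, from the zero iterate: the expected squared error
of its result is bounded by `affineIter`. -/
theorem bnd_descent {S θ D₂ : ℝ} (hA : A ≠ 0) (hS1 : 1 ≤ S)
    (hS : frobNorm A ^ 2 ≤ S * sigmaMin A ^ 2) (hθ : 0 ≤ θ) (hθS : 4 * S * θ ≤ 1) (i : Fin n)
    (α β : ℝ≥0∞) (s : Mem) (h2 : s.idx 2 = i) (h4 : s.idx 4 = 1) (h5 : s.idx 5 = 0)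
    (h7 : s.val 7 = D₂) (h8 : s.val 8 = θ) (h9 : s.val 9 = 1) {a c : ℝ} (ha : a = 1 - θ / S)
    (hc : c = 6 * S * (l2norm b ^ 2 / frobNorm A ^ 2) * θ ^ 2) (f : Mem → ℝ≥0∞)
    (hf : ∀ s', Frame s s' →
      f s' ≤ α + β * ENNReal.ofReal (‖s'.val 14 - (pinv A).mulVec b i‖ ^ 2)) :
    Bnd A b descentProg (60 * (⌈D₂⌉₊ + 1) ^ 2) s f
      (α + β * ENNReal.ofReal (affineIter a c ⌈D₂⌉₊ (l2norm ((pinv A).mulVec b) ^ 2))) := by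
  classical
  set N := ⌈D₂⌉₊ with hN
  set good : ℕ → Mem → Prop := fun k s' =>
    Frame s s' ∧ k ≤ N ∧ s'.idx 6 = 100 + (N - k) ∧ s'.val 13 = (N - k : ℕ) with hgood
  set J : ℕ → Mem → ℝ≥0∞ := fun k s' => if good k s' then
    α + β * ENNReal.ofReal (affineIter a c k (sqError A b (iterate A s' (N - k)))) else ⊤ with hJ
  have hloop : ∀ s', Bnd A b (.loop (.valLt 13 7) stepProg) (N * (16 * N + 39 + 1) + 1) s' (J 0)
      (J N s') := by
    refine Bnd.loop J ?_ ?_ N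
    · intro s' hs'
      have hg : good 0 s' := by by_contra h; exact hs' (if_neg h)
      refine ⟨?_, le_rfl⟩
      simp only [Test.holds, hg.2.2.2, hg.1.2 7 (by decide), h7, Nat.sub_zero, Complex.natCast_re,
        Complex.ofReal_re, not_lt]
      exact Nat.le_ceil D₂
    · intro k s' hs'
      have hg : good (k + 1) s' := by by_contra h; exact hs' (if_neg h)
      have hJs : J (k + 1) s' = α + β * ENNReal.ofReal
          (affineIter a c (k + 1) (sqError A b (iterate A s' (N - (k + 1))))) := if_pos hg
      obtain ⟨hfr, hk, h6, h13⟩ := hg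
      have ht : N - (k + 1) + 1 = N - k := by omega
      refine ⟨?_, ?_⟩
      · simp only [Test.holds, h13, hfr.2 7 (by decide), h7, Complex.natCast_re,
          Complex.ofReal_re]
        exact Nat.lt_ceil.1 (by omega)
      · rw [hJs]
        refine (bnd_step hA hS1 hS hθ hθS k α β s' (N - (k + 1)) ((hfr.1 4 (by decide)).trans h4) h6
          ((hfr.2 8 (by decide)).trans h8) ((hfr.2 9 (by decide)).trans h9) h13 ha hc (J k)
          ?_).mono (by omega) (fun _ => le_rfl) le_rfl
        intro s'' hfr' h6' h13'
        rw [ht] at h6' h13' ⊢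
        exact le_of_eq (if_pos ⟨hfr.trans hfr', by omega, h6', h13'⟩)
  have hlast : ∀ s', Bnd A b (.seq (.block [.idxAdd 8 2 5]) iterateEntryProg) (16 * N + 11) s' f
      (J 0 s') := by
    intro s'
    by_cases hg : good 0 s'
    · have hJs : J 0 s' = α + β * ENNReal.ofReal
          (affineIter a c 0 (sqError A b (iterate A s' (N - 0)))) := if_pos hg
      obtain ⟨hfr, -, h6, -⟩ := hg
      rw [Nat.sub_zero] at h6 hJs
      have hfr₁ : Frame s' (s'.setIdx 8 (s'.idx 2 + s'.idx 5)) := by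
        refine ⟨fun y hy => ?_, fun y _ => rfl⟩
        have e1 : y ≠ 8 := by omega
        simp [Mem.setIdx, e1]
      obtain ⟨s'', hdet, h14, hi, hv⟩ := det_iterateEntry (A := A) (b := b)
        (s'.setIdx 8 (s'.idx 2 + s'.idx 5)) N
        (by simpa [Mem.setIdx] using (hfr.1 4 (by decide)).trans h4)
        (by simpa [Mem.setIdx] using h6)
      have hfr₂ : Frame (s'.setIdx 8 (s'.idx 2 + s'.idx 5)) s'' :=
        ⟨fun y hy => hi y (by omega) (by omega), fun y hy => hv y (by omega) (by omega) (by omega)⟩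
      refine (((Det.block [.idxAdd 8 2 5] rfl s').seq hdet) f).mono
        (by simp only [List.length_cons, List.length_nil]; omega) (fun _ => le_rfl) ?_
      refine (hf s'' ((hfr.trans hfr₁).trans hfr₂)).trans ?_
      have hidx : (s'.setIdx 8 (s'.idx 2 + s'.idx 5)).idx 8 = (i : ℕ) := by
        simp [Mem.setIdx, hfr.1 2 (by decide), hfr.1 5 (by decide), h2, h5]
      have hit : iterate A (s'.setIdx 8 (s'.idx 2 + s'.idx 5)) N = iterate A s' N :=
        iterate_congr N (fun q => by simp [Mem.setIdx, array_ne]) fun q => rfl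
      rw [h14, hidx, hit, entryAt_val, hJs, affineIter_zero]
      gcongr
      exact pow_le_pow_left₀ (norm_nonneg _)
        (norm_le_l2norm (fun l => iterate A s' N l - (pinv A).mulVec b l) i) 2
    · rw [show J 0 s' = ⊤ from if_neg hg]
      exact Bnd.of_top _ _ _ _
  refine ((Det.block [.valConst 13 0 0, .idxConst 6 100] rfl s).bnd_seq
    ((hloop _).seq hlast)).mono ?_ (fun _ => le_rfl) ?_
  · simp only [List.length_cons, List.length_nil]
    nlinarith
  · have hg : good N ([Instr.valConst 13 0 0, .idxConst 6 100].foldl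
        (fun s i => i.next A b s) s) := by
      refine ⟨⟨fun y hy => ?_, fun y hy => ?_⟩, le_rfl, ?_, ?_⟩
      · have e1 : y ≠ 6 := by omega
        simp [Instr.next, Mem.setIdx, Mem.setVal, e1]
      · have e1 : y ≠ 13 := by omega
        simp [Instr.next, Mem.setIdx, Mem.setVal, e1]
      · simp [Instr.next, Mem.setIdx, Mem.setVal]
      · simp [Instr.next, Mem.setIdx, Mem.setVal]
    rw [show J N _ = _ from if_pos hg, Nat.sub_self]
    refine le_of_eq ?_
    simp [sqError, iterate, l2norm]

/-! ### Amplification by a biased walk -/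

/-- The exponential potential of the distance `|m - x|`, measured in units of `h`. -/
noncomputable def walkPotential (h x m : ℝ) : ℝ := 2 ^ (|m - x| / h)

theorem walkPotential_pos (h x m : ℝ) : 0 < walkPotential h x m := by
  unfold walkPotential; positivity

/-- A step of the walk towards `z` halves the potential if `z` is within `w h` of `x` and `m` is not,
and at most doubles it in any case. The last term covers the bad samples, for which
`(w h)² ≤ |z - x|² ≤ y`; its expectation is controlled by that of the squared error of `z`. -/
theorem walkPotential_nudge_le {h : ℝ} (hh : 0 < h) {w : ℕ} (hw : 1 ≤ w) (m x z : ℝ) {y : ℝ}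
    (hy : |z - x| ^ 2 ≤ y) :
    walkPotential h x (m + if m < z then h else -h) ≤
      walkPotential h x m / 2 + 2 * 2 ^ w +
        2 / (w * h) ^ 2 * walkPotential h x m * y := by
  have hw' : (1 : ℝ) ≤ w := by exact_mod_cast hw
  have hP := walkPotential_pos h x m
  have hy0 : 0 ≤ y := (sq_nonneg _).trans hy
  have hstep : walkPotential h x (m + if m < z then h else -h) ≤ 2 * walkPotential h x m := by
    unfold walkPotential
    rw [mul_comm, ← Real.rpow_add_one (by norm_num)]
    refine Real.rpow_le_rpow_of_exponent_le (by norm_num) ?_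
    rw [div_add_one hh.ne']
    gcongr
    split_ifs
    · rw [show m + h - x = (m - x) + h by ring]
      exact (abs_add_le _ _).trans (by rw [abs_of_pos hh])
    · rw [show m + -h - x = (m - x) + -h by ring]
      exact (abs_add_le _ _).trans (by rw [abs_neg, abs_of_pos hh])
  have hlast : 0 ≤ 2 / (w * h) ^ 2 * walkPotential h x m * y := by positivity
  by_cases hz : |z - x| ≤ w * h
  · by_cases hm : |m - x| ≤ w * h
    · have : walkPotential h x m ≤ 2 ^ w := by
        unfold walkPotential
        rw [← Real.rpow_natCast]
        exact Real.rpow_le_rpow_of_exponent_le (by norm_num) ((div_le_iff₀ hh).2 hm)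
      nlinarith
    · push Not at hm
      have hhalf : walkPotential h x (m + if m < z then h else -h) ≤ walkPotential h x m / 2 := by
        unfold walkPotential
        rw [← Real.rpow_sub_one (by norm_num)]
        refine Real.rpow_le_rpow_of_exponent_le (by norm_num) ?_
        rw [div_sub_one hh.ne']
        gcongr
        have hwh : h ≤ w * h := le_mul_of_one_le_left hh.le hw'
        rw [abs_le] at hz
        rcases lt_abs.1 hm with h1 | h1
        · rw [if_neg (by linarith), abs_of_pos (by linarith : 0 < m - x), abs_le]
          constructor <;> linarith
        · rw [if_pos (by linarith), abs_of_neg (by linarith : m - x < 0), abs_le]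
          constructor <;> linarith
      have : (0 : ℝ) ≤ 2 * 2 ^ w := by positivity
      linarith
  · push Not at hz
    have h1 : (w * h) ^ 2 ≤ y := (pow_le_pow_left₀ (by positivity) hz.le 2).trans hy
    have h2 : 2 * walkPotential h x m ≤ 2 / (w * h) ^ 2 * walkPotential h x m * y := by
      rw [div_mul_eq_mul_div, div_mul_eq_mul_div, le_div_iff₀ (by positivity)]
      exact mul_le_mul_of_nonneg_left h1 (by positivity)
    have : (0 : ℝ) ≤ 2 * 2 ^ w := by positivity
    linarith

/-- The move of the estimate `m` by `h` towards `z` in both coordinates. -/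
noncomputable def nudge (h : ℝ) (m z : ℂ) : ℂ :=
  ⟨m.re + if m.re < z.re then h else -h, m.im + if m.im < z.im then h else -h⟩

/-- The sum of the potentials of the two coordinates. -/
noncomputable def potential (h : ℝ) (x m : ℂ) : ℝ :=
  walkPotential h x.re m.re + walkPotential h x.im m.im

theorem potential_pos (h : ℝ) (x m : ℂ) : 0 < potential h x m :=
  add_pos (walkPotential_pos _ _ _) (walkPotential_pos _ _ _)

theorem potential_nudge_le {h : ℝ} (hh : 0 < h) {w : ℕ} (hw : 1 ≤ w) (m x z : ℂ) :
    potential h x (nudge h m z) ≤ potential h x m / 2 + 4 * 2 ^ w +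
      2 / (w * h) ^ 2 * potential h x m * ‖z - x‖ ^ 2 := by
  have h1 := walkPotential_nudge_le hh hw m.re x.re z.re (y := ‖z - x‖ ^ 2)
    (pow_le_pow_left₀ (abs_nonneg _) (by simpa using Complex.abs_re_le_norm (z - x)) 2)
  have h2 := walkPotential_nudge_le hh hw m.im x.im z.im (y := ‖z - x‖ ^ 2)
    (pow_le_pow_left₀ (abs_nonneg _) (by simpa using Complex.abs_im_le_norm (z - x)) 2)
  unfold potential nudge
  simp only
  linarith

theorem potential_zero_le {h L : ℝ} (hh : 0 < h) {x : ℂ} (hx : ‖x‖ ≤ L) :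
    potential h x 0 ≤ 2 * 2 ^ (L / h) := by
  have : ∀ y : ℝ, |y| ≤ ‖x‖ → walkPotential h y 0 ≤ 2 ^ (L / h) := fun y hy => by
    unfold walkPotential
    rw [zero_sub, abs_neg]
    exact Real.rpow_le_rpow_of_exponent_le (by norm_num)
      (div_le_div_of_nonneg_right (hy.trans hx) hh.le)
  have h1 := this _ (Complex.abs_re_le_norm x)
  have h2 := this _ (Complex.abs_im_le_norm x)
  unfold potential
  simp only [Complex.zero_re, Complex.zero_im]
  linarith

/-- An estimate at distance more than `4 w h` has large potential. -/
theorem le_potential {h : ℝ} (hh : 0 < h) (w : ℕ) {m x : ℂ} (hm : 4 * w * h < ‖m - x‖) :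
    4 ^ w ≤ potential h x m := by
  have key : ∀ y x : ℝ, 2 * w * h ≤ |y - x| → (4 : ℝ) ^ w ≤ walkPotential h x y := by
    intro y x hy
    unfold walkPotential
    rw [show (4 : ℝ) ^ w = 2 ^ ((2 * w : ℕ) : ℝ) by rw [Real.rpow_natCast, pow_mul]; norm_num]
    refine Real.rpow_le_rpow_of_exponent_le (by norm_num) ?_
    rw [le_div_iff₀ hh]
    push_cast
    exact hy
  have h1 := Complex.norm_le_abs_re_add_abs_im (m - x)
  rw [Complex.sub_re, Complex.sub_im] at h1
  by_cases h2 : 2 * w * h ≤ |m.re - x.re|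
  · exact (key _ _ h2).trans (le_add_of_nonneg_right (walkPotential_pos _ _ _).le)
  · exact (key m.im x.im (by linarith)).trans (le_add_of_nonneg_left (walkPotential_pos _ _ _).le)

theorem det_nudge (s : Mem) {h : ℝ} (h3 : s.val 3 = -Complex.I) (h4 : s.val 4 = h * Complex.I)
    (h10 : s.val 10 = h) :
    ∃ s', Det A b nudgeProg 15 s s' ∧ s'.val 0 = nudge h (s.val 0) (s.val 14) ∧
      (∀ x, s'.idx x = s.idx x) ∧ ∀ x ≤ 12, x ≠ 0 → s'.val x = s.val x := by
  have hre : ∃ s', Det A b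
      (.ite (.valLt 0 14) (.block [.valAdd 0 0 10]) (.block [.valSub 0 0 10])) 4 s s' ∧
      s' = s.setVal 0 (s.val 0 + ((if (s.val 0).re < (s.val 14).re then h else -h : ℝ) : ℂ)) := by
    by_cases hlt : (s.val 0).re < (s.val 14).re
    · refine ⟨_, (Det.ite_pos (τ := .valLt 0 14) hlt (Det.block _ rfl s)).mono (by simp), ?_⟩
      simp [Instr.next, hlt, h10]
    · refine ⟨_, (Det.ite_neg (τ := .valLt 0 14) hlt (Det.block _ rfl s)).mono (by simp), ?_⟩
      simp [Instr.next, hlt, h10, sub_eq_add_neg]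
  obtain ⟨s₁, hdet₁, hs₁⟩ := hre
  have hdet₂ := Det.block (A := A) (b := b) [.valMul 15 0 3, .valMul 16 14 3] rfl s₁
  set s₂ := [Instr.valMul 15 0 3, .valMul 16 14 3].foldl (fun s i => i.next A b s) s₁ with hs₂
  have hre : (s.val 0 + ((if (s.val 0).re < (s.val 14).re then h else -h : ℝ) : ℂ)).re =
      (s.val 0).re + if (s.val 0).re < (s.val 14).re then h else -h := by
    rw [Complex.add_re, Complex.ofReal_re]
  have him : (s.val 0 + ((if (s.val 0).re < (s.val 14).re then h else -h : ℝ) : ℂ)).im =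
      (s.val 0).im := by
    rw [Complex.add_im, Complex.ofReal_im, add_zero]
  have h0 : s₂.val 0 =
      s.val 0 + ((if (s.val 0).re < (s.val 14).re then h else -h : ℝ) : ℂ) := by
    rw [hs₂, hs₁]
    simp only [List.foldl, Instr.next, Mem.setVal]
    simp
  have h4' : s₂.val 4 = h * Complex.I := by
    simp [hs₂, hs₁, Instr.next, Mem.setVal, h4]
  have htest : (s₂.val 15).re < (s₂.val 16).re ↔ (s.val 0).im < (s.val 14).im := by
    have e15 : s₂.val 15 =
        (s.val 0 + ((if (s.val 0).re < (s.val 14).re then h else -h : ℝ) : ℂ)) * -Complex.I := by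
      rw [hs₂, hs₁]
      simp only [List.foldl, Instr.next, Mem.setVal]
      simp [h3]
    have e16 : s₂.val 16 = s.val 14 * -Complex.I := by
      rw [hs₂, hs₁]
      simp only [List.foldl, Instr.next, Mem.setVal]
      simp [h3]
    have : ∀ y : ℂ, (y * -Complex.I).re = y.im := fun y => by simp
    rw [e15, e16, this, this, him]
  have hidx : ∀ x, s₂.idx x = s.idx x := fun x => by rw [hs₂, hs₁]; rfl
  have hval : ∀ x ≤ 12, x ≠ 0 → s₂.val x = s.val x := by
    intro x hx hx0
    have e1 : x ≠ 15 := by omega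
    have e2 : x ≠ 16 := by omega
    rw [hs₂, hs₁]
    simp [Instr.next, Mem.setVal, hx0, e1, e2]
  have hfin : ∃ s', Det A b
      (.ite (.valLt 15 16) (.block [.valAdd 0 0 4]) (.block [.valSub 0 0 4])) 4 s₂ s' ∧
      s' = s₂.setVal 0 (nudge h (s.val 0) (s.val 14)) := by
    have hn : nudge h (s.val 0) (s.val 14) = s₂.val 0 +
        ((if (s.val 0).im < (s.val 14).im then h else -h : ℝ) : ℂ) * Complex.I := by
      rw [h0]
      apply Complex.ext
      · rw [Complex.add_re, hre, Complex.re_ofReal_mul]; simp [nudge]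
      · rw [Complex.add_im, him, Complex.im_ofReal_mul]; simp [nudge]
    by_cases hlt : (s.val 0).im < (s.val 14).im
    · refine ⟨_, (Det.ite_pos (τ := .valLt 15 16) (htest.2 hlt) (Det.block _ rfl s₂)).mono (by simp), ?_⟩
      simp [Instr.next, hn, hlt, h4']
    · refine ⟨_, (Det.ite_neg (τ := .valLt 15 16) (fun hc => hlt (htest.1 hc)) (Det.block _ rfl s₂)).mono
        (by simp), ?_⟩
      simp [Instr.next, hn, hlt, h4', sub_eq_add_neg]
  obtain ⟨s₃, hdet₃, hs₃⟩ := hfin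
  refine ⟨s₃, (hdet₁.seq (hdet₂.seq hdet₃)).mono (by simp), ?_, ?_, ?_⟩
  · simp [hs₃, Mem.setVal]
  · intro x; rw [hs₃]; exact hidx x
  · intro x hx hx0
    rw [hs₃, ← hval x hx hx0]
    simp [Mem.setVal, hx0]

/-! ### The choice of the parameters -/

/-- The memory holds the parameters of the amplification: `D` determines the number of steps `D²` and
the step size `1 / D` of the descent, `h` is the step of the walk, and `ρ` is the number of
rounds. -/
structure Ready (i : ℕ) (D h ρ : ℝ) (s : Mem) : Prop where
  idx2 : s.idx 2 = i
  idx4 : s.idx 4 = 1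
  idx5 : s.idx 5 = 0
  val3 : s.val 3 = -Complex.I
  val4 : s.val 4 = h * Complex.I
  val7 : s.val 7 = (D ^ 2 : ℝ)
  val8 : s.val 8 = (1 / D : ℝ)
  val9 : s.val 9 = 1
  val10 : s.val 10 = h
  val11 : s.val 11 = ρ

theorem Ready.congr {i : ℕ} {D h ρ : ℝ} {s s' : Mem} (hs : Ready i D h ρ s)
    (hi : ∀ x ≤ 5, s'.idx x = s.idx x) (hv : ∀ x ≤ 11, x ≠ 0 → s'.val x = s.val x) :
    Ready i D h ρ s' where
  idx2 := (hi 2 (by decide)).trans hs.idx2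
  idx4 := (hi 4 (by decide)).trans hs.idx4
  idx5 := (hi 5 (by decide)).trans hs.idx5
  val3 := (hv 3 (by decide) (by decide)).trans hs.val3
  val4 := (hv 4 (by decide) (by decide)).trans hs.val4
  val7 := (hv 7 (by decide) (by decide)).trans hs.val7
  val8 := (hv 8 (by decide) (by decide)).trans hs.val8
  val9 := (hv 9 (by decide) (by decide)).trans hs.val9
  val10 := (hv 10 (by decide) (by decide)).trans hs.val10
  val11 := (hv 11 (by decide) (by decide)).trans hs.val11

theorem det_setup {s : Mem} {i k ℓ : ℕ} {κ ε δ S D h ρ : ℝ} (h2 : s.idx 2 = i) (h3 : s.idx 3 = k)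
    (h5 : s.idx 5 = 0) (hκ : s.val 0 = κ) (hε : s.val 1 = ε) (hδ : s.val 2 = δ)
    (hℓ : (1 / 2 : ℝ) ^ ℓ ≤ δ) (hℓ' : ∀ q < ℓ, δ < (1 / 2 : ℝ) ^ q)
    (hS : S = 1 + k * κ ^ 2) (hD : D = (S * (l2norm b / frobNorm A / ε) ^ 2 + 1) * S * 4096)
    (hh : h = ε / 4 / (ℓ + 5 : ℕ)) (hρ : ρ = D * (ℓ + 5 : ℕ)) :
    ∃ s', Det A b setupProg (6 * k + 6 * ℓ + 65) s s' ∧ Ready i D h ρ s' ∧ s'.val 0 = 0 ∧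
      s'.val 12 = 0 := by
  set I₁ : ℕ → Mem → Prop := fun r s' => (∃ q, q + r = k ∧ s'.idx 3 = r ∧
    s'.val 5 = ((1 + q * κ ^ 2 : ℝ) : ℂ)) ∧ s'.idx 2 = i ∧ s'.idx 4 = 1 ∧ s'.idx 5 = 0 ∧
    s'.val 1 = ε ∧ s'.val 2 = δ ∧ s'.val 9 = 1 ∧ s'.val 15 = ((κ ^ 2 : ℝ) : ℂ) with hI₁
  obtain ⟨s₁, hdet₁, hs₁⟩ := Det.loop (A := A) (b := b) (τ := .idxLt 5 3) (t := 5)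
    (p := .block [.valAdd 5 5 15, .idxSub 3 3 4]) I₁ (by
      rintro s' ⟨⟨q, hq, e3, -⟩, -, -, e5, -⟩
      simp [Test.holds, e3, e5]) (by
      rintro r s' ⟨⟨q, hq, e3, e5v⟩, e2, e4, e5, e1v, e2v, e9, e15⟩
      refine ⟨by simp [Test.holds, e3, e5], _, Det.block _ rfl _, ⟨q + 1, by omega, ?_, ?_⟩,
        ?_, ?_, ?_, ?_, ?_, ?_, ?_⟩
      · simp [Instr.next, Mem.setIdx, Mem.setVal, e3, e4]
      · simp [Instr.next, Mem.setIdx, Mem.setVal, e5v, e15]; ring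
      all_goals simp [Instr.next, Mem.setIdx, Mem.setVal, *]) k
    ([Instr.valConst 9 1 0, .valConst 5 1 0, .valMul 15 0 0, .idxConst 4 1].foldl
      (fun s i => i.next A b s) s) (by
      refine ⟨⟨0, by omega, ?_, ?_⟩, ?_, ?_, ?_, ?_, ?_, ?_, ?_⟩
      all_goals simp [Instr.next, Mem.setIdx, Mem.setVal, h2, h3, h5, hκ, hε, hδ, sq])
  obtain ⟨⟨q, hq, -, e5v⟩, e2, e4, e5, e1v, e2v, e9, -⟩ := hs₁
  obtain rfl : q = k := by omega
  rw [← hS] at e5v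
  set l₂ : List Instr := [.matNorm 16, .vecNorm 17, .valDiv 16 17 16, .valDiv 16 16 1,
    .valMul 16 16 16, .valMul 16 16 5, .valAdd 16 16 9, .valMul 6 16 5, .valConst 17 4096 0,
    .valMul 6 6 17, .valMul 7 6 6, .valDiv 8 9 6, .valConst 18 1 0, .valConst 19 5 0,
    .valConst 17 (1 / 2) 0] with hl₂
  set I₂ : ℕ → Mem → Prop := fun r s' => (∃ q, q + r = ℓ ∧
    s'.val 18 = (((1 / 2) ^ q : ℝ) : ℂ) ∧ s'.val 19 = ((q + 5 : ℕ) : ℂ)) ∧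
    s'.idx 2 = i ∧ s'.idx 4 = 1 ∧ s'.idx 5 = 0 ∧ s'.val 1 = ε ∧ s'.val 2 = δ ∧ s'.val 9 = 1 ∧
    s'.val 6 = D ∧ s'.val 7 = (D ^ 2 : ℝ) ∧ s'.val 8 = (1 / D : ℝ) ∧
    s'.val 17 = 1 / 2 with hI₂
  obtain ⟨s₂, hdet₂, hs₂⟩ := Det.loop (A := A) (b := b) (τ := .valLt 2 18) (t := 5)
    (p := .block [.valMul 18 18 17, .valAdd 19 19 9]) I₂ (by
      rintro s' ⟨⟨q, hq, e18, -⟩, -, -, -, -, e2', -⟩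
      obtain rfl : q = ℓ := by omega
      simp only [Test.holds, e18, e2', Complex.ofReal_re, not_lt]
      exact hℓ) (by
      rintro r s' ⟨⟨q, hq, e18, e19⟩, a2, a4, a5, a1, a2', a9, a6, a7, a8, a17⟩
      refine ⟨?_, _, Det.block _ rfl _, ⟨q + 1, by omega, ?_, ?_⟩,
        ?_, ?_, ?_, ?_, ?_, ?_, ?_, ?_, ?_, ?_⟩
      · simp only [Test.holds, e18, a2', Complex.ofReal_re]
        exact hℓ' q (by omega)
      · simp [Instr.next, Mem.setVal, e18, a17, pow_succ]
      · simp [Instr.next, Mem.setVal, e19, a9]; ring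
      all_goals simp [Instr.next, Mem.setVal, *]) ℓ
    (l₂.foldl (fun s i => i.next A b s) s₁) (by
      have hDc : ((D : ℝ) : ℂ) = (S * (l2norm b / frobNorm A / ε) ^ 2 + 1) * S * 4096 := by
        rw [hD]; push_cast; ring
      refine ⟨⟨0, by omega, ?_, ?_⟩, ?_, ?_, ?_, ?_, ?_, ?_, ?_, ?_, ?_, ?_⟩
      case refine_9 =>
        simp [hl₂, Instr.next, Mem.setVal, e5v, e9, e1v]; rw [hDc]; ring
      case refine_10 =>
        simp [hl₂, Instr.next, Mem.setVal, e5v, e9, e1v]; rw [hDc]; ring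
      case refine_11 =>
        simp [hl₂, Instr.next, Mem.setVal, e5v, e9, e1v, hDc]; left; ring
      all_goals simp [Instr.next, Mem.setVal, *])
  obtain ⟨⟨q, hq, -, e19⟩, a2, a4, a5, a1, -, a9, a6, a7, a8, -⟩ := hs₂
  obtain rfl : q = ℓ := by omega
  refine ⟨_, (((Det.block _ rfl s).seq (hdet₁.seq ((Det.block _ rfl s₁).seq
    (hdet₂.seq (Det.block _ rfl s₂)))))).mono ?_, ⟨?_, ?_, ?_, ?_, ?_, ?_, ?_, ?_, ?_, ?_⟩, ?_, ?_⟩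
  · simp only [hl₂, List.length_cons, List.length_nil]; omega
  case refine_6 =>
    simp [Instr.next, Mem.setVal, a1, e19, hh]; ring
  case refine_10 =>
    simp [Instr.next, Mem.setVal, a1, e19, hh]; ring
  case refine_11 =>
    simp [Instr.next, Mem.setVal, a6, e19, hρ]
  all_goals simp [Instr.next, Mem.setVal, *]

/-! ### Error and time bounds -/

theorem one_sub_pow_le {t : ℝ} (ht : 0 < t) (ht1 : t ≤ 1) {N : ℕ} (hN : 0 < N) :
    (1 - t) ^ N ≤ 1 / (N * t) := by
  have hN' : (0 : ℝ) < N := by exact_mod_cast hN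
  have h1 : 1 + N * t ≤ (1 + t) ^ N := one_add_mul_le_pow (by linarith) N
  have h2 : (1 - t) ^ N * (1 + t) ^ N ≤ 1 := by
    rw [← mul_pow]
    exact pow_le_one₀ (by nlinarith) (by nlinarith)
  have h3 : 0 ≤ (1 - t) ^ N := pow_nonneg (by linarith) N
  rw [le_div_iff₀ (by positivity)]
  nlinarith [mul_le_mul_of_nonneg_left h1 h3]

/-- With step size `1 / D` and at least `D²` steps, the final error of the descent is small:
`z` bounds the squared norm of the solution, and `B` stands for `‖b‖² / ‖A‖_F²`. -/
theorem descent_error_le {S B ε D z : ℝ} (hS : 1 ≤ S) (hB : 0 ≤ B) (hε : 0 < ε)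
    (hD : D = (S * (B / ε ^ 2) + 1) * S * 4096) (hz : z ≤ S * B) :
    affineIter (1 - 1 / D / S) (6 * S * B * (1 / D) ^ 2) ⌈D ^ 2⌉₊ z ≤ (ε / 4) ^ 2 / 16 := by
  have hg : 0 ≤ S * (B / ε ^ 2) := by positivity
  have hDS : S * 4096 ≤ D := by
    rw [hD]; nlinarith [mul_nonneg hg (by positivity : 0 ≤ S)]
  have hD0 : 0 < D := by linarith
  have hSB : S ^ 2 * B / D ≤ ε ^ 2 / 4096 := by
    rw [div_le_iff₀ hD0]
    have : ε ^ 2 / 4096 * D = S ^ 2 * B + S * ε ^ 2 := by rw [hD]; field_simp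
    rw [this]
    have : 0 ≤ S * ε ^ 2 := by positivity
    linarith
  have ht0 : 0 < 1 / D / S := by positivity
  have ht1 : 1 / D / S ≤ 1 := by
    rw [div_div, div_le_one (by positivity)]; nlinarith
  have hN : 0 < ⌈D ^ 2⌉₊ := Nat.ceil_pos.2 (by positivity)
  have hpow : (1 - 1 / D / S) ^ ⌈D ^ 2⌉₊ ≤ S / D := by
    refine (one_sub_pow_le ht0 ht1 hN).trans ?_
    rw [div_le_div_iff₀ (by positivity) hD0]
    have : D ^ 2 * (1 / D / S) * S = D := by field_simp
    have h2 : D ^ 2 * (1 / D / S) ≤ ⌈D ^ 2⌉₊ * (1 / D / S) :=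
      mul_le_mul_of_nonneg_right (Nat.le_ceil _) ht0.le
    nlinarith
  refine (affineIter_le (by linarith) (by linarith) (by positivity) _ _).trans ?_
  have h1 : (1 - 1 / D / S) ^ ⌈D ^ 2⌉₊ * z ≤ S ^ 2 * B / D := by
    calc _ ≤ (1 - 1 / D / S) ^ ⌈D ^ 2⌉₊ * (S * B) :=
          mul_le_mul_of_nonneg_left hz (pow_nonneg (by linarith) _)
      _ ≤ S / D * (S * B) := mul_le_mul_of_nonneg_right hpow (by positivity)
      _ = _ := by ring
  have h2 : 6 * S * B * (1 / D) ^ 2 / (1 - (1 - 1 / D / S)) = 6 * (S ^ 2 * B / D) := by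
    rw [sub_sub_cancel]; field_simp
  rw [h2]
  have : 0 < ε ^ 2 := by positivity
  nlinarith

/-- One round of the amplification: if the expected squared error of a descent is at most
`(w h)² / 16`, the expected potential is multiplied by at most `5 / 8 = 1 / 2 + 2 / 16` and increased
by `4 * 2 ^ w`. -/
theorem bnd_round {S D h ρ : ℝ} {w : ℕ} (hA : A ≠ 0) (hS1 : 1 ≤ S)
    (hS : frobNorm A ^ 2 ≤ S * sigmaMin A ^ 2) (hD : S * 4096 ≤ D) (hh : 0 < h) (hw : 1 ≤ w)
    (i : Fin n)
    (herr : affineIter (1 - 1 / D / S) (6 * S * (l2norm b ^ 2 / frobNorm A ^ 2) * (1 / D) ^ 2)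
      ⌈D ^ 2⌉₊ (l2norm ((pinv A).mulVec b) ^ 2) ≤ (w * h) ^ 2 / 16)
    {c : ℝ} (hc : 0 ≤ c) (k r : ℕ) (s : Mem) (hs : Ready i D h ρ s) (h12 : s.val 12 = r)
    (f : Mem → ℝ≥0∞)
    (hf : ∀ s', Ready i D h ρ s' → s'.val 12 = (r + 1 : ℕ) → f s' ≤ ENNReal.ofReal
      (affineIter (5 / 8) (4 * 2 ^ w) k (potential h ((pinv A).mulVec b i) (s'.val 0)) * c)) :
    Bnd A b roundProg (60 * (⌈D ^ 2⌉₊ + 1) ^ 2 + 20) s f (ENNReal.ofReal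
      (affineIter (5 / 8) (4 * 2 ^ w) (k + 1)
        (potential h ((pinv A).mulVec b i) (s.val 0)) * c)) := by
  classical
  have hD0 : 0 < D := by linarith
  have hdet := Det.block (A := A) (b := b) [.valAdd 12 12 9] rfl s
  set s₁ := [Instr.valAdd 12 12 9].foldl (fun s i => i.next A b s) s with hs₁
  have hs₁' : Ready i D h ρ s₁ := hs.congr (fun x _ => rfl) fun x hx _ => by
    have e1 : x ≠ 12 := by omega
    simp [hs₁, Instr.next, Mem.setVal, e1]
  have h12' : s₁.val 12 = (r + 1 : ℕ) := by
    simp [hs₁, Instr.next, Mem.setVal, h12, hs.val9]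
  have h0 : s₁.val 0 = s.val 0 := by simp [hs₁, Instr.next, Mem.setVal]
  set x := (pinv A).mulVec b i with hx
  set V := potential h x (s.val 0) with hV
  have hV0 : 0 < V := potential_pos _ _ _
  set η := 2 / (w * h) ^ 2 * V with hη
  have hη0 : 0 ≤ η := by positivity
  set g : Mem → ℝ≥0∞ := fun s' => if Frame s₁ s' then ENNReal.ofReal
    (affineIter (5 / 8) (4 * 2 ^ w) k (V / 2 + 4 * 2 ^ w + η * ‖s'.val 14 - x‖ ^ 2) * c) else ⊤
    with hg
  have hsplit : ∀ y : ℝ, 0 ≤ y → ENNReal.ofReal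
      (affineIter (5 / 8) (4 * 2 ^ w) k (V / 2 + 4 * 2 ^ w + η * y) * c) =
      ENNReal.ofReal (affineIter (5 / 8) (4 * 2 ^ w) k (V / 2 + 4 * 2 ^ w) * c) +
        ENNReal.ofReal ((5 / 8) ^ k * η * c) * ENNReal.ofReal y := by
    intro y hy
    rw [← ENNReal.ofReal_mul (by positivity), ← ENNReal.ofReal_add
      (mul_nonneg (affineIter_nonneg (by norm_num) (by positivity) _ (by positivity)) hc)
      (by positivity)]
    congr 1
    unfold affineIter
    ring
  have hnudge : ∀ s', Bnd A b nudgeProg 15 s' f (g s') := by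
    intro s'
    by_cases hfr : Frame s₁ s'
    · have hs' : Ready i D h ρ s' :=
        hs₁'.congr (fun x hx => hfr.1 x hx) fun x hx _ => hfr.2 x (by omega)
      obtain ⟨s'', hdet', h0', hi, hv⟩ := det_nudge (A := A) (b := b) s' hs'.val3 hs'.val4 hs'.val10
      refine (hdet' f).mono le_rfl (fun _ => le_rfl) ?_
      rw [show g s' = _ from if_pos hfr]
      refine (hf s'' (hs'.congr (fun x _ => hi x) fun x hx hx0 => hv x (by omega) hx0) ?_).trans ?_
      · rw [hv 12 (by decide) (by decide), hfr.2 12 (by decide), h12']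
      · refine ENNReal.ofReal_le_ofReal (mul_le_mul_of_nonneg_right
          (affineIter_mono (by norm_num) _ ?_) hc)
        rw [h0']
        have := potential_nudge_le hh hw (s'.val 0) x (s'.val 14)
        rw [hfr.2 0 (by decide), h0] at this ⊢
        exact this
    · rw [show g s' = ⊤ from if_neg hfr]
      exact Bnd.of_top _ _ _ _
  have hdesc := bnd_descent hA hS1 hS (θ := 1 / D) (D₂ := D ^ 2) (by positivity)
    (by rw [mul_one_div, div_le_one hD0]; linarith) i
    (ENNReal.ofReal (affineIter (5 / 8) (4 * 2 ^ w) k (V / 2 + 4 * 2 ^ w) * c))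
    (ENNReal.ofReal ((5 / 8) ^ k * η * c)) s₁ hs₁'.idx2 hs₁'.idx4 hs₁'.idx5 hs₁'.val7 hs₁'.val8
    hs₁'.val9 rfl rfl g (fun s' hfr => by
      rw [show g s' = _ from if_pos hfr, hsplit _ (sq_nonneg _)])
  refine (hdet.bnd_seq (hdesc.seq hnudge)).mono
    (by simp only [List.length_cons, List.length_nil]; omega) (fun _ => le_rfl) ?_
  rw [← hsplit _ (affineIter_nonneg (sub_nonneg.2 ?_) (by positivity) _ (by positivity))]
  · refine ENNReal.ofReal_le_ofReal (mul_le_mul_of_nonneg_right ?_ hc)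
    rw [affineIter_succ]
    refine affineIter_mono (by norm_num) _ ?_
    have h1 := mul_le_mul_of_nonneg_left herr hη0
    have hw0 : (0 : ℝ) < w := by exact_mod_cast hw
    have h2 : η * ((w * h) ^ 2 / 16) = V / 8 := by rw [hη]; field_simp; norm_num
    linarith
  · rw [div_div, div_le_one (by positivity)]
    nlinarith

/-- After `ρ ≥ D w` rounds, the potential has decayed to its stationary level. -/
theorem walk_error_le {S B ε D h δ : ℝ} {w ℓ : ℕ} {x : ℂ} (hS : 1 ≤ S) (hB : 0 ≤ B) (hε : 0 < ε)
    (hD : D = (S * (B / ε ^ 2) + 1) * S * 4096) (hx : ‖x‖ ^ 2 ≤ S * B) (hw : w = ℓ + 5)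
    (hℓ : (1 / 2 : ℝ) ^ ℓ ≤ δ) (hh : h = ε / 4 / w) :
    affineIter (5 / 8) (4 * 2 ^ w) ⌈D * w⌉₊ (potential h x 0) * (1 / 4 ^ w) ≤ δ := by
  have hw0 : (0 : ℝ) < w := by rw [hw]; positivity
  have hh0 : 0 < h := by rw [hh]; positivity
  set g := S * (B / ε ^ 2) with hg
  have hg0 : 0 ≤ g := by positivity
  have hxn : ‖x‖ ≤ ε * (1 + g) := by
    refine le_of_sq_le_sq ?_ (by positivity)
    have : S * B = ε ^ 2 * g := by rw [hg]; field_simp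
    nlinarith [sq_nonneg g, sq_nonneg ε, mul_nonneg (sq_nonneg ε) hg0,
      mul_nonneg (sq_nonneg ε) (sq_nonneg g)]
  have hV := potential_zero_le hh0 hxn
  have hLh : 2 * (ε * (1 + g) / h) ≤ ⌈D * w⌉₊ := by
    refine le_trans ?_ (Nat.le_ceil _)
    have : ε * (1 + g) / h = 4 * w * (1 + g) := by rw [hh]; field_simp
    rw [this, hD]
    have h1 : (1 + g) * 8 ≤ (g + 1) * S * 4096 := by nlinarith
    nlinarith
  have hdecay : (5 / 8 : ℝ) ^ ⌈D * w⌉₊ * 2 ^ (ε * (1 + g) / h) ≤ 1 := by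
    have h1 : (2 : ℝ) ^ (ε * (1 + g) / h) ≤ (8 / 5) ^ ⌈D * w⌉₊ := by
      calc (2 : ℝ) ^ (ε * (1 + g) / h) ≤ ((8 / 5 : ℝ) ^ (2 : ℝ)) ^ (ε * (1 + g) / h) := by
            refine Real.rpow_le_rpow (by norm_num) ?_ (by positivity)
            norm_num
        _ = (8 / 5) ^ (2 * (ε * (1 + g) / h)) := by rw [← Real.rpow_mul (by norm_num)]
        _ ≤ (8 / 5) ^ (⌈D * w⌉₊ : ℝ) := Real.rpow_le_rpow_of_exponent_le (by norm_num) hLh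
        _ = _ := Real.rpow_natCast _ _
    calc _ ≤ (5 / 8 : ℝ) ^ ⌈D * w⌉₊ * (8 / 5) ^ ⌈D * w⌉₊ := by gcongr
      _ = 1 := by rw [← mul_pow]; norm_num
  have hmain : affineIter (5 / 8) (4 * 2 ^ w) ⌈D * w⌉₊ (potential h x 0) ≤
      2 + 4 * 2 ^ w * (8 / 3) := by
    refine (affineIter_le (by norm_num) (by norm_num) (by positivity) _ _).trans ?_
    have : (5 / 8 : ℝ) ^ ⌈D * w⌉₊ * potential h x 0 ≤ 2 := by
      have := mul_le_mul_of_nonneg_left hV (by positivity : (0 : ℝ) ≤ (5 / 8 : ℝ) ^ ⌈D * w⌉₊)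
      linarith
    have h2 : (4 * 2 ^ w / (1 - 5 / 8) : ℝ) = 4 * 2 ^ w * (8 / 3) := by ring
    linarith
  have h4 : (4 : ℝ) ^ w = 2 ^ w * 2 ^ w := by rw [← mul_pow]; norm_num
  have h2w : (2 : ℝ) ^ w = 32 * 2 ^ ℓ := by rw [hw, pow_add]; ring
  have hp : (1 : ℝ) ≤ 2 ^ ℓ := one_le_pow₀ (by norm_num)
  have hδ : 1 ≤ δ * 2 ^ ℓ := by
    have := mul_le_mul_of_nonneg_right hℓ (by positivity : (0 : ℝ) ≤ 2 ^ ℓ)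
    rwa [← mul_pow, show (1 / 2 * 2 : ℝ) = 1 by norm_num, one_pow] at this
  rw [mul_one_div, div_le_iff₀ (by positivity), h4, h2w]
  rw [h2w] at hmain
  refine hmain.trans ?_
  nlinarith [mul_le_mul_of_nonneg_right hδ (by positivity : (0 : ℝ) ≤ 2 ^ ℓ)]

/-- The final estimate is wrong with probability at most `δ`: a wrong estimate has potential at least
`4 ^ w`, so Markov's inequality applies to the expected potential after all rounds. -/
theorem bnd_solver {S D ε δ : ℝ} {ℓ : ℕ} (hA : A ≠ 0) (i : Fin n) (hε : 0 < ε)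
    (hℓ : (1 / 2 : ℝ) ^ ℓ ≤ δ) (hℓ' : ∀ q < ℓ, δ < (1 / 2 : ℝ) ^ q)
    (hSdef : S = 1 + A.rank * condNumber A ^ 2)
    (hD : D = (S * (l2norm b / frobNorm A / ε) ^ 2 + 1) * S * 4096) (s : Mem)
    (hs : s = (Config.init solverProg A i ε δ).mem) :
    Bnd A b solverProg (6 * A.rank + 6 * ℓ + 67 +
        ⌈D * (ℓ + 5 : ℕ)⌉₊ * (60 * (⌈D ^ 2⌉₊ + 1) ^ 2 + 21)) s
      (fun s' => open Classical in if ‖s'.val 0 - (pinv A).mulVec b i‖ ≤ ε then 0 else 1)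
      (ENNReal.ofReal δ) := by
  classical
  set w := ℓ + 5 with hw
  set h := ε / 4 / w with hh
  have hw0 : (0 : ℝ) < w := by rw [hw]; positivity
  have hh0 : 0 < h := by positivity
  have hF := frobNorm_pos hA
  obtain ⟨s₁, hdet, hs₁, h0, h12⟩ := det_setup (A := A) (b := b) (s := s) (i := i) (k := A.rank)
    (κ := condNumber A) (ε := ε) (by rw [hs]; rfl) (by rw [hs]; rfl) (by rw [hs]; rfl)
    (by rw [hs]; rfl) (by rw [hs]; rfl) (by rw [hs]; rfl) hℓ hℓ' hSdef hD hh rfl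
  set x := (pinv A).mulVec b i with hx
  set B := l2norm b ^ 2 / frobNorm A ^ 2 with hB
  have hB0 : 0 ≤ B := by positivity
  have hS1 : 1 ≤ S := by rw [hSdef]; nlinarith [sq_nonneg (condNumber A), A.rank.cast_nonneg (α := ℝ)]
  have hS : frobNorm A ^ 2 ≤ S * sigmaMin A ^ 2 := by
    refine (sq_frobNorm_le_rank_mul_condNumber hA).trans ?_
    rw [hSdef]
    nlinarith [sq_nonneg (sigmaMin A)]
  have hD' : D = (S * (B / ε ^ 2) + 1) * S * 4096 := by rw [hD, hB, div_pow, div_pow]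
  have hDS : S * 4096 ≤ D := by
    have hg : 0 ≤ S * (B / ε ^ 2) := by positivity
    rw [hD']; nlinarith [mul_nonneg hg (by positivity : 0 ≤ S)]
  have hz : l2norm ((pinv A).mulVec b) ^ 2 ≤ S * B := by
    have h := sigmaMin_mul_l2norm_pinv_le hA b
    rw [hB, ← mul_div_assoc, le_div_iff₀ (by positivity)]
    nlinarith [mul_le_mul_of_nonneg_right hS (sq_nonneg (l2norm ((pinv A).mulVec b)))]
  have hxz : ‖x‖ ^ 2 ≤ S * B :=
    (pow_le_pow_left₀ (norm_nonneg _) (norm_le_l2norm _ i) 2).trans hz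
  have hwh : w * h = ε / 4 := by rw [hh]; field_simp
  set N := ⌈D * w⌉₊ with hN
  set good : ℕ → Mem → Prop := fun k s' =>
    Ready i D h (D * w) s' ∧ k ≤ N ∧ s'.val 12 = (N - k : ℕ) with hgood
  set J : ℕ → Mem → ℝ≥0∞ := fun k s' => if good k s' then ENNReal.ofReal
    (affineIter (5 / 8) (4 * 2 ^ w) k (potential h x (s'.val 0)) * (1 / 4 ^ w)) else ⊤ with hJ
  have hloop := Bnd.loop (A := A) (b := b) (τ := .valLt 12 11) (p := roundProg)
    (t := 60 * (⌈D ^ 2⌉₊ + 1) ^ 2 + 20)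
    (f := fun s' => if ‖s'.val 0 - x‖ ≤ ε then 0 else 1) J (by
      intro s' hs'
      have hg : good 0 s' := by by_contra h; exact hs' (if_neg h)
      refine ⟨?_, ?_⟩
      · simp only [Test.holds, hg.2.2, hg.1.val11, Nat.sub_zero, Complex.natCast_re,
          Complex.ofReal_re, not_lt]
        exact Nat.le_ceil _
      · rw [show J 0 s' = _ from if_pos hg, affineIter_zero]
        split_ifs with hgd
        · exact zero_le
        · rw [← ENNReal.ofReal_one]
          refine ENNReal.ofReal_le_ofReal ?_
          rw [mul_one_div, one_le_div (by positivity)]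
          exact le_potential hh0 w (by rw [mul_assoc, hwh]; push Not at hgd; linarith)) (by
      intro k s' hs'
      have hg : good (k + 1) s' := by by_contra h; exact hs' (if_neg h)
      rw [show J (k + 1) s' = _ from if_pos hg]
      obtain ⟨hr, hk, h12'⟩ := hg
      refine ⟨?_, bnd_round hA hS1 hS hDS hh0 (by omega) i ?_ (by positivity) k (N - (k + 1)) s' hr
        h12' (J k) ?_⟩
      · simp only [Test.holds, h12', hr.val11, Complex.natCast_re, Complex.ofReal_re]
        exact Nat.lt_ceil.1 (by omega)
      · rw [hwh]
        exact descent_error_le hS1 hB0 hε hD' hz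
      · intro s'' hr' h12''
        rw [show N - (k + 1) + 1 = N - k by omega] at h12''
        exact le_of_eq (if_pos ⟨hr', by omega, h12''⟩)) N s₁
  refine (hdet.bnd_seq hloop).mono (by linarith) (fun _ => le_of_eq (by congr)) ?_
  rw [show J N s₁ = _ from if_pos ⟨hs₁, le_rfl, by rw [h12, Nat.sub_self, Nat.cast_zero]⟩, h0]
  exact ENNReal.ofReal_le_ofReal (walk_error_le hS1 hB0 hε hD' hxz hw hℓ hh)

/-- The number of halvings that bring `1` below `δ`, as counted by the program. -/
theorem exists_halving {δ : ℝ} (hδ : 0 < δ) (hδ1 : δ < 1) :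
    ∃ ℓ : ℕ, (1 / 2 : ℝ) ^ ℓ ≤ δ ∧ (∀ q < ℓ, δ < (1 / 2 : ℝ) ^ q) ∧
      (ℓ : ℝ) ≤ 1 + 2 * Real.log (1 / δ) := by
  classical
  have hex : ∃ ℓ : ℕ, (1 / 2 : ℝ) ^ ℓ ≤ δ :=
    (exists_pow_lt_of_lt_one hδ (by norm_num)).imp fun _ h => h.le
  refine ⟨Nat.find hex, Nat.find_spec hex, fun q hq => not_le.1 (Nat.find_min hex hq), ?_⟩
  by_cases h0 : Nat.find hex = 0
  · rw [h0, Nat.cast_zero]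
    have := Real.log_nonneg (one_le_one_div hδ hδ1.le)
    linarith
  · obtain ⟨q, hq⟩ := Nat.exists_eq_succ_of_ne_zero h0
    have hlt : δ < (1 / 2 : ℝ) ^ q := not_le.1 (Nat.find_min hex (by omega))
    have h1 := Real.log_lt_log hδ hlt
    rw [Real.log_pow, one_div, Real.log_inv] at h1
    rw [hq, Nat.cast_succ, one_div, Real.log_inv]
    nlinarith [Real.log_two_gt_d9, q.cast_nonneg (α := ℝ)]

/-- The time bound is polynomial in the scale `Q` of the problem, and linear in `w`. -/
theorem time_le {D Q K : ℝ} {k ℓ w : ℕ} (hK : K = 1200 * 8192 ^ 5 + 100) (hw : w = ℓ + 5) (hQ : 1 ≤ Q) (hk : k ≤ Q) (hD1 : 1 ≤ D)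
    (hD : D ≤ 8192 * Q ^ 12) :
    ((6 * k + 6 * ℓ + 67 + ⌈D * w⌉₊ * (60 * (⌈D ^ 2⌉₊ + 1) ^ 2 + 21) : ℕ) : ℝ) ≤
      K * Q ^ 60 * w := by
  rw [hK]
  have hw1 : (1 : ℝ) ≤ w := by rw [hw]; push_cast; linarith [ℓ.cast_nonneg (α := ℝ)]
  have hℓ : (ℓ : ℝ) ≤ w := by rw [hw]; push_cast; linarith
  have h1 : (⌈D * w⌉₊ : ℝ) ≤ 2 * (D * w) := by
    have := Nat.ceil_lt_add_one (by positivity : 0 ≤ D * w)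
    nlinarith
  have hD2 : 1 ≤ D ^ 2 := one_le_pow₀ hD1
  have h2 : (⌈D ^ 2⌉₊ : ℝ) + 1 ≤ 3 * D ^ 2 := by
    have := Nat.ceil_lt_add_one (by positivity : 0 ≤ D ^ 2)
    linarith
  have h3 : (60 * ((⌈D ^ 2⌉₊ : ℝ) + 1) ^ 2 + 21) ≤ 600 * D ^ 4 := by
    have := pow_le_pow_left₀ (by positivity) h2 2
    have h4 : 1 ≤ D ^ 4 := one_le_pow₀ hD1
    nlinarith
  have h5 : (⌈D * w⌉₊ : ℝ) * (60 * ((⌈D ^ 2⌉₊ : ℝ) + 1) ^ 2 + 21) ≤ 1200 * D ^ 5 * w :=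
    (mul_le_mul h1 h3 (by positivity) (by positivity)).trans (le_of_eq (by ring))
  have h6 : D ^ 5 ≤ 8192 ^ 5 * Q ^ 60 := by
    refine (pow_le_pow_left₀ (by positivity) hD 5).trans (le_of_eq (by ring))
  have h7 : Q ≤ Q ^ 60 := le_self_pow₀ hQ (by norm_num)
  have h8 : 1 ≤ Q ^ 60 := one_le_pow₀ hQ
  have h9 : 1200 * D ^ 5 * w ≤ 1200 * (8192 ^ 5 * Q ^ 60) * w := by gcongr
  have h10 : Q ≤ Q ^ 60 * w := by nlinarith
  have h11 : (w : ℝ) ≤ Q ^ 60 * w := by nlinarith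
  push_cast
  linarith

/-- The parameter `D` is polynomial in the quantities that the time bound may depend on. -/
theorem scale_bounds {S D ε : ℝ} (hA : A ≠ 0) (hε : 0 < ε)
    (hS : S = 1 + A.rank * condNumber A ^ 2)
    (hD : D = (S * (l2norm b / frobNorm A / ε) ^ 2 + 1) * S * 4096) :
    1 ≤ 1 + A.rank + condNumber A + frobNorm A + 1 / specNorm A + l2norm b + 1 / ε ∧
    A.rank ≤ 1 + A.rank + condNumber A + frobNorm A + 1 / specNorm A + l2norm b + 1 / ε ∧
    1 ≤ D ∧
    D ≤ 8192 *
      (1 + A.rank + condNumber A + frobNorm A + 1 / specNorm A + l2norm b + 1 / ε) ^ 12 := by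
  obtain ⟨Q, hQdef⟩ : ∃ Q, Q = 1 + A.rank + condNumber A + frobNorm A + 1 / specNorm A +
      l2norm b + 1 / ε := ⟨_, rfl⟩
  rw [← hQdef]
  have hF := frobNorm_pos hA
  have hs := specNorm_pos hA
  have hκ := condNumber_nonneg A hA
  have hb := l2norm_nonneg b
  have hk : (0 : ℝ) ≤ A.rank := A.rank.cast_nonneg
  have hε' : 0 < 1 / ε := by positivity
  have hs' : 0 < 1 / specNorm A := by positivity
  have hQ1 : 1 ≤ Q := by rw [hQdef]; linarith
  have hFQ : 1 / frobNorm A ≤ Q :=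
    (one_div_le_one_div_of_le hs specNorm_le_frobNorm).trans (by rw [hQdef]; linarith)
  have hS1 : 1 ≤ S := by rw [hS]; nlinarith [sq_nonneg (condNumber A)]
  have hSQ : S ≤ Q ^ 3 := by
    have h1 : condNumber A ^ 2 ≤ Q ^ 2 := pow_le_pow_left₀ hκ (by rw [hQdef]; linarith) 2
    have h2 : (A.rank : ℝ) * condNumber A ^ 2 ≤ (Q - 1) * Q ^ 2 :=
      mul_le_mul (by rw [hQdef]; linarith) h1 (sq_nonneg _) (by linarith)
    rw [hS]
    nlinarith
  have hratio : (l2norm b / frobNorm A / ε) ^ 2 ≤ Q ^ 6 := by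
    have : l2norm b / frobNorm A / ε ≤ Q * Q * Q := by
      rw [div_eq_mul_one_div, div_eq_mul_one_div (l2norm b)]
      refine mul_le_mul (mul_le_mul ?_ hFQ (by positivity) (by linarith)) ?_ hε'.le (by positivity)
      · rw [hQdef]; linarith
      · rw [hQdef]; linarith
    exact (pow_le_pow_left₀ (by positivity) this 2).trans (le_of_eq (by ring))
  have hDQ : D ≤ 8192 * Q ^ 12 := by
    have h1 : S * (l2norm b / frobNorm A / ε) ^ 2 + 1 ≤ 2 * Q ^ 9 := by
      have h2 := mul_le_mul hSQ hratio (by positivity) (by positivity)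
      rw [← pow_add] at h2
      have h9 : 1 ≤ Q ^ 9 := one_le_pow₀ hQ1
      linarith
    have h3 := mul_le_mul h1 hSQ (by positivity) (by positivity)
    rw [mul_assoc, ← pow_add] at h3
    rw [hD]
    linarith
  have hD1 : 1 ≤ D := by
    have h1 : 0 ≤ S * (l2norm b / frobNorm A / ε) ^ 2 := by positivity
    rw [hD]
    nlinarith
  exact ⟨hQ1, by rw [hQdef]; linarith, hD1, hDQ⟩

end Program

theorem theorem1 :
    ∃ (prog : Prog) (C d : ℕ),
      ∀ (m n : ℕ) (A : Matrix (Fin m) (Fin n) ℂ) (b : Fin m → ℂ) (i : Fin n) (ε δ : ℝ),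
        A ≠ 0 → 0 < ε → 0 < δ → δ < 1 →
        ∃ T : ℕ,
          (T : ℝ) ≤ C * (1 + A.rank + condNumber A + frobNorm A + 1 / specNorm A + l2norm b
                + 1 / ε) ^ d
              * (1 + Real.log m + Real.log n) ^ d * (1 + Real.log (1 / δ)) ∧
          (∀ c ∈ ((Config.init prog A i ε δ).run A b T).support, c.todo = [] ∧ c.queries ≤ T) ∧
          ENNReal.ofReal (1 - δ) ≤
            ((Config.init prog A i ε δ).run A b T).toOuterMeasure
              {c | c.todo = [] ∧ ‖c.mem.val 0 - (pinv A).mulVec b i‖ ≤ ε} := by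
  obtain ⟨K, hK⟩ : ∃ K : ℕ, (K : ℝ) = 1200 * 8192 ^ 5 + 100 :=
    ⟨1200 * 8192 ^ 5 + 100, by norm_num⟩
  refine ⟨solverProg, 6 * K, 60, ?_⟩
  intro m n A b i ε δ hA hε hδ hδ1
  obtain ⟨ℓ, hℓ, hℓ', hlog⟩ := exists_halving hδ hδ1
  refine ⟨_, ?_, Bnd.run_init hδ.le (bnd_solver hA i hε hℓ hℓ' rfl rfl _ rfl)⟩
  obtain ⟨hQ1, hk, hD1, hDQ⟩ := scale_bounds (b := b) hA hε rfl rfl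
  generalize 1 + A.rank + condNumber A + frobNorm A + 1 / specNorm A + l2norm b + 1 / ε = Q at *
  have hlog0 := Real.log_nonneg (one_le_one_div hδ hδ1.le)
  have hw : ((ℓ + 5 : ℕ) : ℝ) ≤ 6 * (1 + Real.log (1 / δ)) := by
    push_cast
    linarith
  have hmn : (1 : ℝ) ≤ (1 + Real.log m + Real.log n) ^ 60 :=
    one_le_pow₀ (by linarith [Real.log_natCast_nonneg m, Real.log_natCast_nonneg n])
  refine (time_le hK rfl hQ1 hk hD1 hDQ).trans ?_
  calc K * Q ^ 60 * ((ℓ + 5 : ℕ) : ℝ)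
      ≤ K * Q ^ 60 * (6 * (1 + Real.log (1 / δ))) := mul_le_mul_of_nonneg_left hw (by positivity)
    _ = (6 * K : ℕ) * Q ^ 60 * 1 * (1 + Real.log (1 / δ)) := by push_cast; ring
    _ ≤ _ := mul_le_mul_of_nonneg_right
        (mul_le_mul_of_nonneg_left hmn (by positivity)) (by positivity)
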